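/- Let $n\ge 1$, let $\Omega_1,\Omega_2\subset\mathbb R^n$ be open, and let $f:\Omega_1\to\Omega_2$ be a homeomorphism of $\Omega_1$ onto $\Omega_2$ with $f\in W^{1,1}_{\mathrm{loc}}(\Omega_1,\mathbb R^n)$. Let $Df$ denote its weak derivative, $J_f=\det Df$, and let $|\cdot|$ be the Euclidean (Frobenius) norm on $n\times n$ matrices. For open $G\subset\Omega_1$ put $$|Df|(G)=\sup\Big\{\sum_{i=1}^n\int_G f_i\,\operatorname{div}\varphi_i\,dx:\ \varphi\in C^1_c(G,\mathbb R^{n\times n}),\ |\varphi(x)|\le 1 \text{ for all } x\Big\}\in[0,\infty],$$ and for a Borel set $E\subset\Omega_1$ let $|Df|(E)=\inf\{|Df|(G): G \text{ open},\ E\subset G\subset\Omega_1\}$ be the total variation measure of the distributional derivative. Let $1\le q<\infty$ and $\frac1q+\frac1{q'}=1$ (so $q'=\infty$ if $q=1$). Then the following are equivalent: (i) there is a nonnegative function $K\in L^{q'}(\Omega_2)$ such that $$|Df|\big(f^{-1}(A)\big)\le\int_A K(y)\,dy\quad\text{for all Borel sets } A\subset\Omega_2;$$ (ii) there is a function $L\in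 L^{q'}(\Omega_1)$ such that $$|Df(x)|\le L(x)\,|J_f(x)|^{1/q}\quad\text{for a.e. } x\in\Omega_1.$$ -/

import Mathlib

open MeasureTheory Set
open scoped ENNReal ContDiff Matrix.Norms.Frobenius

/-- `ℝⁿ` with the Euclidean norm. -/
abbrev Rn (n : ℕ) : Type := EuclideanSpace ℝ (Fin n)

/-- The classical partial derivative `∂ψ/∂xⱼ` at `x`. -/
noncomputable def partialDeriv {n : ℕ} (j : Fin n) (ψ : Rn n → ℝ) (x : Rn n) : ℝ :=
  fderiv ℝ ψ x (EuclideanSpace.single j 1)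

/-- `u` belongs to `W^{1,1}_loc(Ω, ℝᵈ)` and the matrix field `Du` represents its distributional
derivative on the open set `Ω`: the entry `(i, j)` is the weak derivative `∂uᵢ/∂xⱼ`, tested
against `C_c^∞(Ω)`. -/
structure HasLocSobolevDeriv {n d : ℕ} (Ω : Set (Rn n)) (u : Rn n → Rn d)
    (Du : Rn n → Matrix (Fin d) (Fin n) ℝ) : Prop where
  locallyIntegrableOn : LocallyIntegrableOn u Ω volume
  locallyIntegrableOn_deriv : ∀ i j, LocallyIntegrableOn (fun x => Du x i j) Ω volume
  integral_mul_partialDeriv : ∀ (i : Fin d) (j : Fin n) (φ : Rn n → ℝ),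
    ContDiff ℝ ∞ φ → HasCompactSupport φ → tsupport φ ⊆ Ω →
      ∫ x in Ω, u x i * partialDeriv j φ x = - ∫ x in Ω, Du x i j * φ x

/-- `φ ∈ C_c^1(G, ℝ^{d×n})` with `|φ(x)| ≤ 1` everywhere, `|·|` being the Euclidean (Frobenius)
norm of matrices. -/
structure IsTestField {n d : ℕ} (G : Set (Rn n)) (φ : Rn n → Matrix (Fin d) (Fin n) ℝ) :
    Prop where
  contDiff : ∀ i j, ContDiff ℝ 1 (fun x => φ x i j)
  hasCompactSupport : HasCompactSupport φ
  tsupport_subset : tsupport φ ⊆ G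
  norm_le_one : ∀ x, ‖φ x‖ ≤ 1

/-- The total variation of the distributional derivative on an open set `G`:
`sup ∑ᵢ ∫_G uᵢ div φᵢ` over all test fields `φ` in `G`. -/
noncomputable def openVariation {n d : ℕ} (u : Rn n → Rn d) (G : Set (Rn n)) : ℝ≥0∞ :=
  ⨆ (φ : Rn n → Matrix (Fin d) (Fin n) ℝ) (_ : IsTestField G φ),
    ENNReal.ofReal
      (∑ i, ∫ x in G, u x i * ∑ j, partialDeriv j (fun y => φ y i j) x)

/-- The total variation measure `|Du|` on (Borel) subsets `E` of the open set `Ω`: the outer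
regular extension of its values on open sets. -/
noncomputable def totalVariation {n d : ℕ} (Ω : Set (Rn n)) (u : Rn n → Rn d)
    (E : Set (Rn n)) : ℝ≥0∞ :=
  ⨅ (G : Set (Rn n)) (_ : IsOpen G) (_ : E ⊆ G) (_ : G ⊆ Ω), openVariation u G

/-! For a continuous Sobolev map the variation measure is `|Df| dx`, so (i) says that the
push-forward of `|Df| dx` under `f` is dominated by `K dy`. The link with the Jacobian is the area
formula `∫_{f(E)} g = ∫_E |J_f| (g ∘ f)`. A Sobolev homeomorphism may violate Lusin's condition (N),
so the formula is claimed only for `E` inside a set `S` of full measure; both implications use it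
only there.

From (i), taking `A = f(E)` with `E ⊆ S` gives `∫_E |Df| ≤ ∫_E |J_f| (K ∘ f)`, hence `|Df| ≤ |J_f|
(K ∘ f)` a.e. Then `L = |Df| |J_f|^(-1/q)` works: since `1 - q' = -q'/q`, one has `L^q' = |J_f|
(|Df|/|J_f|)^q' ≤ |J_f| (K ∘ f)^q'`, and the area formula bounds the integral. From (ii), `Df`
vanishes a.e. where `J_f` does, and `K = (|Df|/|J_f|) ∘ f⁻¹` on the image of `S ∩ {J_f ≠ 0}`, zero
elsewhere, works by the same computation.

Two analytic facts carry this. `HasLocSobolevDeriv.totalVariation_eq` identifies the variation, by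
duality with mollified fields `-Df/|Df|`. `HasLocSobolevDeriv.exists_lintegral_image_eq` gives the
area formula: `f` is differentiable with derivative `Df` relative to each of countably many
measurable sets covering almost all of the domain, and the change of variables formula applies on
each. These sets come from the weak `(1,1)` maximal inequality for differences of successive
mollifications and from the Borel–Cantelli lemma. -/

set_option linter.unusedSectionVars false

/-! ### Maximal function and Lipschitz estimates for `C¹` maps -/

section MaximalFunction

open Metric

theorem enorm_sub_le_lintegral_fderiv {E F : Type*} [NormedAddCommGroup E] [NormedSpace ℝ E]
    [NormedAddCommGroup F] [NormedSpace ℝ F] [CompleteSpace F] {v : E → F}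
    (hv : ContDiff ℝ 1 v) (x h : E) :
    ‖v (x + h) - v x‖ₑ ≤ ∫⁻ t in Ioc (0 : ℝ) 1, ‖fderiv ℝ v (x + t • h)‖ₑ * ‖h‖ₑ := by
  have hd : ∀ t : ℝ, HasDerivAt (fun t : ℝ => v (x + t • h)) (fderiv ℝ v (x + t • h) h) t := by
    intro t
    have h1 : HasDerivAt (fun t : ℝ => x + t • h) h t := by
      simpa using ((hasDerivAt_id t).smul_const h).const_add x
    exact ((hv.differentiable one_ne_zero _).hasFDerivAt).comp_hasDerivAt t h1
  have hc : Continuous fun t : ℝ => fderiv ℝ v (x + t • h) h :=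
    ((hv.continuous_fderiv one_ne_zero).comp (by fun_prop)).clm_apply continuous_const
  have h2 := intervalIntegral.integral_eq_sub_of_hasDerivAt (fun t _ => hd t)
    (hc.intervalIntegrable 0 1)
  simp only [one_smul, zero_smul, add_zero] at h2
  rw [← h2, intervalIntegral.integral_of_le zero_le_one]
  refine (enorm_integral_le_lintegral_enorm _).trans (lintegral_mono fun t => ?_)
  exact ContinuousLinearMap.le_opENorm _ _

variable {E F : Type*} [NormedAddCommGroup E] [NormedSpace ℝ E] [FiniteDimensional ℝ E]
  [MeasurableSpace E] [BorelSpace E] (μ : Measure E) [μ.IsAddHaarMeasure]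
  [NormedAddCommGroup F] [NormedSpace ℝ F] [CompleteSpace F]

/-- The points at which some average of `g` over a closed ball of radius at most `1` exceeds `c`. -/
def maximalSuperlevel (g : E → ℝ≥0∞) (c : ℝ≥0∞) : Set E :=
  {x | ∃ s : ℝ, 0 < s ∧ s ≤ 1 ∧ c * μ (closedBall x s) < ∫⁻ y in closedBall x s, g y ∂μ}

/-- Weak type `(1, 1)` estimate for the local maximal function. -/
theorem mul_measure_maximalSuperlevel_le (g : E → ℝ≥0∞) (c : ℝ≥0∞) :
    c * μ (maximalSuperlevel μ g c) ≤ 5 ^ Module.finrank ℝ E * ∫⁻ y, g y ∂μ := by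
  choose! r hr0 hr1 hr using fun x (hx : x ∈ maximalSuperlevel μ g c) => hx
  -- Vitali covering needs bounded radii, hence the cap at `1`. Enlarging the disjoint balls five
  -- times costs the factor `5 ^ finrank`.
  obtain ⟨u, hut, hdisj, hcov⟩ := Vitali.exists_disjoint_subfamily_covering_enlargement_closedBall
    (maximalSuperlevel μ g c) (fun x => x) r 1 hr1 5 (by norm_num)
  have hcount : u.Countable := by
    apply hdisj.countable_of_nonempty_interior
    intro a ha
    exact ⟨a, ball_subset_interior_closedBall (mem_ball_self (hr0 a (hut ha)))⟩
  have hsub : maximalSuperlevel μ g c ⊆ ⋃ a ∈ u, closedBall a (5 * r a) := by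
    intro x hx
    obtain ⟨b, hb, hxb⟩ := hcov x hx
    exact mem_biUnion hb (hxb (mem_closedBall_self (hr0 x hx).le))
  have key : ∀ a ∈ u, c * μ (closedBall a (5 * r a)) ≤
      5 ^ Module.finrank ℝ E * ∫⁻ y in closedBall a (r a), g y ∂μ := by
    intro a ha
    rw [Measure.addHaar_closedBall_mul μ a (by norm_num) (hr0 a (hut ha)).le,
      ← Measure.addHaar_closedBall_center μ a]
    calc c * (ENNReal.ofReal (5 ^ Module.finrank ℝ E) * μ (closedBall a (r a)))
        = 5 ^ Module.finrank ℝ E * (c * μ (closedBall a (r a))) := by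
          rw [ENNReal.ofReal_pow (by norm_num), ENNReal.ofReal_ofNat]; ring
      _ ≤ _ := by gcongr; exact (hr a (hut ha)).le
  calc c * μ (maximalSuperlevel μ g c) ≤ c * ∑' a : u, μ (closedBall (a : E) (5 * r a)) := by
        gcongr; exact (measure_mono hsub).trans (measure_biUnion_le μ hcount _)
    _ = ∑' a : u, c * μ (closedBall (a : E) (5 * r a)) := ENNReal.tsum_mul_left.symm
    _ ≤ ∑' a : u, 5 ^ Module.finrank ℝ E * ∫⁻ y in closedBall (a : E) (r a), g y ∂μ :=
        ENNReal.tsum_le_tsum fun a => key a a.2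
    _ = 5 ^ Module.finrank ℝ E * ∑' a : u, ∫⁻ y in closedBall (a : E) (r a), g y ∂μ :=
        ENNReal.tsum_mul_left
    _ = 5 ^ Module.finrank ℝ E * ∫⁻ y in ⋃ a ∈ u, closedBall a (r a), g y ∂μ := by
        rw [lintegral_biUnion hcount (fun a _ => isClosed_closedBall.measurableSet) hdisj]
    _ ≤ _ := by gcongr; exact Measure.restrict_le_self

/-- Substitute `w = x + t • h`: the small ball lies in the ball of radius `d` about the origin, so
its image lies in the ball of radius `t * d` about `x`. -/
theorem setLIntegral_closedBall_comp_homothety_le (G : E → ℝ≥0∞) (x c : E) {d t : ℝ}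
    (ht : 0 < t) (hc : ‖c‖ ≤ d / 2) :
    ∫⁻ h in closedBall c (d / 2), G (x + t • h) ∂μ ≤
      ENNReal.ofReal (t ^ Module.finrank ℝ E)⁻¹ * ∫⁻ w in closedBall x (t * d), G w ∂μ := by
  have hsub : ∀ h ∈ closedBall c (d / 2), x + t • h ∈ closedBall x (t * d) := by
    intro h hh
    rw [mem_closedBall, dist_eq_norm] at hh ⊢
    have h1 : ‖h‖ ≤ d := by
      calc ‖h‖ = ‖(h - c) + c‖ := by simp
        _ ≤ ‖h - c‖ + ‖c‖ := norm_add_le _ _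
        _ ≤ d := by linarith
    rw [add_sub_cancel_left, norm_smul, Real.norm_of_nonneg ht.le]
    gcongr
  have hme : MeasurableEmbedding fun h : E => x + t • h :=
    ((Homeomorph.smulOfNeZero t ht.ne').trans (Homeomorph.addLeft x)).measurableEmbedding
  have hmap : μ.map (fun h : E => x + t • h) =
      ENNReal.ofReal (t ^ Module.finrank ℝ E)⁻¹ • μ := by
    have : (fun h : E => x + t • h) = (fun h => x + h) ∘ (fun h => t • h) := rfl
    rw [this, ← Measure.map_map (measurable_const_add x) (measurable_const_smul t),
      Measure.map_addHaar_smul μ ht.ne', Measure.map_smul, map_add_left_eq_self,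
      abs_of_pos (by positivity)]
  calc ∫⁻ h in closedBall c (d / 2), G (x + t • h) ∂μ
      ≤ ∫⁻ h in (fun h : E => x + t • h) ⁻¹' closedBall x (t * d), G (x + t • h) ∂μ :=
        lintegral_mono_set hsub
    _ = ∫⁻ w in closedBall x (t * d), G w ∂(μ.map fun h : E => x + t • h) := by
        rw [hme.restrict_map, hme.lintegral_map]
    _ = _ := by rw [hmap, Measure.restrict_smul, lintegral_smul_measure, smul_eq_mul]

/-- Integrate the derivative along segments from `x` and exchange integrals. For fixed `t` the
points `x + t • h` stay in a ball about `x` of radius `t * d ≤ 1`, where the average of the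
derivative is at most `c`. The powers of `t` cancel, and passing from radius `d` to `d / 2` gives `2
^ finrank`. -/
theorem lintegral_enorm_sub_le_of_notMem_maximalSuperlevel {v : E → F} (hv : ContDiff ℝ 1 v)
    {x : E} {c : ℝ≥0∞} (hx : x ∉ maximalSuperlevel μ (fun y => ‖fderiv ℝ v y‖ₑ) c)
    {d : ℝ} (hd : 0 < d) (hd1 : d ≤ 1) (p : E) (hp : ‖p‖ ≤ d / 2) :
    ∫⁻ h in closedBall p (d / 2), ‖v (x + h) - v x‖ₑ ∂μ ≤
      ENNReal.ofReal d * (2 ^ Module.finrank ℝ E * c) * μ (closedBall p (d / 2)) := by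
  set N := Module.finrank ℝ E
  have hcont : Continuous fun y => ‖fderiv ℝ v y‖ₑ :=
    (hv.continuous_fderiv one_ne_zero).enorm
  have hin : ∀ t ∈ Ioc (0 : ℝ) 1, ∫⁻ h in closedBall p (d / 2), ‖fderiv ℝ v (x + t • h)‖ₑ ∂μ ≤
      2 ^ N * c * μ (closedBall p (d / 2)) := by
    intro t ht
    refine (setLIntegral_closedBall_comp_homothety_le μ (fun y => ‖fderiv ℝ v y‖ₑ) x p
      ht.1 hp).trans ?_
    have h1 : ∫⁻ w in closedBall x (t * d), ‖fderiv ℝ v w‖ₑ ∂μ ≤ c * μ (closedBall x (t * d)) := by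
      by_contra! hcon
      exact hx ⟨t * d, mul_pos ht.1 hd, by nlinarith [ht.1, ht.2], hcon⟩
    have h2 : μ (closedBall x (t * d)) =
        ENNReal.ofReal (t ^ N) * (2 ^ N * μ (closedBall p (d / 2))) := by
      rw [Measure.addHaar_closedBall_mul μ x ht.1.le hd.le, Measure.addHaar_closedBall_center μ p]
      have : d = 2 * (d / 2) := by ring
      conv_lhs => rw [this]
      rw [Measure.addHaar_closedBall_mul μ 0 (by norm_num) (by positivity),
        ENNReal.ofReal_pow (by norm_num : (0 : ℝ) ≤ 2), ENNReal.ofReal_ofNat]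
    calc ENNReal.ofReal (t ^ N)⁻¹ * ∫⁻ w in closedBall x (t * d), ‖fderiv ℝ v w‖ₑ ∂μ
        ≤ ENNReal.ofReal (t ^ N)⁻¹ *
            (c * (ENNReal.ofReal (t ^ N) * (2 ^ N * μ (closedBall p (d / 2))))) := by
          rw [← h2]; gcongr
      _ = (ENNReal.ofReal (t ^ N)⁻¹ * ENNReal.ofReal (t ^ N)) *
            (2 ^ N * c * μ (closedBall p (d / 2))) := by ring
      _ = _ := by
          have := ht.1
          rw [← ENNReal.ofReal_mul (by positivity), inv_mul_cancel₀ (by positivity)]; simp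
  calc ∫⁻ h in closedBall p (d / 2), ‖v (x + h) - v x‖ₑ ∂μ
      ≤ ∫⁻ h in closedBall p (d / 2),
          (∫⁻ t in Ioc (0 : ℝ) 1, ‖fderiv ℝ v (x + t • h)‖ₑ * ENNReal.ofReal d) ∂μ := by
        refine setLIntegral_mono' isClosed_closedBall.measurableSet fun h hh => ?_
        refine (enorm_sub_le_lintegral_fderiv hv x h).trans (lintegral_mono fun t => ?_)
        gcongr
        rw [← ofReal_norm]
        refine ENNReal.ofReal_le_ofReal ?_
        rw [mem_closedBall, dist_eq_norm] at hh
        calc ‖h‖ = ‖(h - p) + p‖ := by simp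
          _ ≤ ‖h - p‖ + ‖p‖ := norm_add_le _ _
          _ ≤ d := by linarith
    _ = ∫⁻ t in Ioc (0 : ℝ) 1, ∫⁻ h in closedBall p (d / 2),
          ‖fderiv ℝ v (x + t • h)‖ₑ * ENNReal.ofReal d ∂μ := by
        refine lintegral_lintegral_swap (Measurable.aemeasurable ?_)
        have : Continuous fun q : E × ℝ => ‖fderiv ℝ v (x + q.2 • q.1)‖ₑ :=
          hcont.comp (by fun_prop)
        exact this.measurable.mul_const _
    _ ≤ ∫⁻ t in Ioc (0 : ℝ) 1, 2 ^ N * c * μ (closedBall p (d / 2)) * ENNReal.ofReal d := by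
        refine setLIntegral_mono' measurableSet_Ioc fun t ht => ?_
        rw [lintegral_mul_const' _ _ ENNReal.ofReal_ne_top]
        gcongr
        exact hin t ht
    _ = _ := by simp; ring

/-- A `C¹` function is Lipschitz on the set where the maximal function of its derivative is
bounded. -/
theorem enorm_sub_le_of_notMem_maximalSuperlevel {v : E → F} (hv : ContDiff ℝ 1 v)
    {x y : E} {c : ℝ≥0∞} (hx : x ∉ maximalSuperlevel μ (fun y => ‖fderiv ℝ v y‖ₑ) c)
    (hy : y ∉ maximalSuperlevel μ (fun y => ‖fderiv ℝ v y‖ₑ) c) (hxy : dist y x ≤ 1) :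
    ‖v y - v x‖ₑ ≤ 2 ^ (Module.finrank ℝ E + 1) * c * ‖y - x‖ₑ := by
  rcases eq_or_ne y x with rfl | hne
  · simp
  set d := dist y x with hd
  have hd0 : 0 < d := dist_pos.2 hne
  -- Half the displacement: `x + B(p, d/2)` and `y + B(-p, d/2)` are the same ball about the
  -- midpoint, so `v x` and `v y` can both be compared with the values of `v` on it.
  set p : E := (2 : ℝ)⁻¹ • (y - x) with hp
  have hpn : ‖p‖ = d / 2 := by
    rw [hp, norm_smul, hd, dist_eq_norm]; norm_num; ring
  have h1 := lintegral_enorm_sub_le_of_notMem_maximalSuperlevel μ hv hx hd0 hxy p hpn.le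
  have h2 := lintegral_enorm_sub_le_of_notMem_maximalSuperlevel μ hv hy hd0 hxy (-p)
    (by rw [norm_neg]; exact hpn.le)
  have hB0 : μ (closedBall p (d / 2)) ≠ 0 := (measure_closedBall_pos μ p (by positivity)).ne'
  have hBt : μ (closedBall p (d / 2)) ≠ ⊤ := measure_closedBall_lt_top.ne
  have h3 : ∫⁻ h in closedBall (-p) (d / 2), ‖v (y + h) - v y‖ₑ ∂μ =
      ∫⁻ h in closedBall p (d / 2), ‖v (x + h) - v y‖ₑ ∂μ := by
    have hme : MeasurableEmbedding fun h : E => (x - y) + h :=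
      (Homeomorph.addLeft (x - y)).measurableEmbedding
    have hpre : (fun h : E => (x - y) + h) ⁻¹' closedBall (-p) (d / 2) = closedBall p (d / 2) := by
      ext h
      simp only [mem_preimage, mem_closedBall, dist_eq_norm]
      have : x - y + h - -p = h - p := by
        have : y - x = (2 : ℝ) • p := by rw [hp, smul_smul]; norm_num
        rw [two_smul] at this
        rw [← neg_sub y x, this]; abel
      rw [this]
    conv_lhs => rw [← map_add_left_eq_self μ (x - y)]
    rw [hme.restrict_map, hme.lintegral_map, hpre]
    simp_rw [show ∀ h : E, y + (x - y + h) = x + h from fun h => by abel]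
  rw [h3, Measure.addHaar_closedBall_center μ (-p), ← Measure.addHaar_closedBall_center μ p] at h2
  have h4 : ‖v y - v x‖ₑ * μ (closedBall p (d / 2)) ≤
      2 ^ (Module.finrank ℝ E + 1) * c * ‖y - x‖ₑ * μ (closedBall p (d / 2)) := by
    calc ‖v y - v x‖ₑ * μ (closedBall p (d / 2))
        = ∫⁻ h in closedBall p (d / 2), ‖v y - v x‖ₑ ∂μ := by simp
      _ ≤ ∫⁻ h in closedBall p (d / 2), (‖v (x + h) - v x‖ₑ + ‖v (x + h) - v y‖ₑ) ∂μ := by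
          refine lintegral_mono fun h => ?_
          calc ‖v y - v x‖ₑ = ‖(v (x + h) - v x) - (v (x + h) - v y)‖ₑ := by
                congr 1; abel
            _ ≤ _ := enorm_sub_le
      _ = ∫⁻ h in closedBall p (d / 2), ‖v (x + h) - v x‖ₑ ∂μ +
          ∫⁻ h in closedBall p (d / 2), ‖v (x + h) - v y‖ₑ ∂μ := by
          refine lintegral_add_left (Continuous.measurable ?_) _
          exact ((hv.continuous.comp (continuous_const.add continuous_id)).sub
            continuous_const).enorm
      _ ≤ _ := add_le_add h1 h2
      _ = _ := by
          rw [← ofReal_norm (y - x), ← dist_eq_norm, ← hd]; ring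
  exact (ENNReal.mul_le_mul_iff_left hB0 hBt).1 h4

end MaximalFunction

/-! ### Mollification and weak derivatives on the whole space -/

section Mollification

open Metric Filter Topology ContinuousLinearMap
open scoped Convolution

variable {E F : Type*} [NormedAddCommGroup E] [NormedSpace ℝ E] [FiniteDimensional ℝ E]
  [MeasurableSpace E] [BorelSpace E] {μ : Measure E} [μ.IsAddHaarMeasure]
  [NormedAddCommGroup F] [NormedSpace ℝ F] [CompleteSpace F]

/-- A sequence of bump functions at the origin with outer radii `1 / (k + 1)`. -/
noncomputable def shrinkingBump (E : Type*) [NormedAddCommGroup E] (k : ℕ) :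
    ContDiffBump (0 : E) where
  rIn := 1 / (k + 1) / 2
  rOut := 1 / (k + 1)
  rIn_pos := by positivity
  rIn_lt_rOut := half_lt_self (by positivity)

variable (μ) in
/-- The mollification of `g` at scale `1 / (k + 1)`. -/
noncomputable def mollify (g : E → F) (k : ℕ) : E → F :=
  (shrinkingBump E k).normed μ ⋆[lsmul ℝ ℝ, μ] g

theorem tendsto_rOut_shrinkingBump :
    Tendsto (fun k => (shrinkingBump E k).rOut) atTop (𝓝 0) :=
  tendsto_one_div_add_atTop_nhds_zero_nat

theorem rOut_shrinkingBump_le_one (k : ℕ) : (shrinkingBump E k).rOut ≤ 1 := by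
  change (1 : ℝ) / (k + 1) ≤ 1
  rw [div_le_one (by positivity)]
  linarith [(Nat.cast_nonneg k : (0 : ℝ) ≤ k)]

theorem contDiff_mollify {g : E → F} (hg : LocallyIntegrable g μ) (n : ℕ∞) (k : ℕ) :
    ContDiff ℝ n (mollify μ g k) :=
  (shrinkingBump E k).hasCompactSupport_normed.contDiff_convolution_left _
    (shrinkingBump E k).contDiff_normed hg

theorem tendsto_mollify_of_continuous {g : E → F} (hg : Continuous g) (x : E) :
    Tendsto (fun k => mollify μ g k x) atTop (𝓝 (g x)) :=
  ContDiffBump.convolution_tendsto_right_of_continuous tendsto_rOut_shrinkingBump hg x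

theorem ae_tendsto_mollify {g : E → F} (hg : LocallyIntegrable g μ) :
    ∀ᵐ x ∂μ, Tendsto (fun k => mollify μ g k x) atTop (𝓝 (g x)) := by
  refine ContDiffBump.ae_convolution_tendsto_right_of_locallyIntegrable (K := 2)
    tendsto_rOut_shrinkingBump (Eventually.of_forall fun k => ?_) hg
  change (1 : ℝ) / (k + 1) ≤ 2 * (1 / (k + 1) / 2)
  linarith

theorem lintegral_enorm_shrinkingBump (k : ℕ) :
    ∫⁻ t, ‖(shrinkingBump E k).normed μ t‖ₑ ∂μ = 1 := by
  rw [← ofReal_integral_norm_eq_lintegral_enorm (shrinkingBump E k).integrable_normed]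
  simp_rw [Real.norm_of_nonneg ((shrinkingBump E k).nonneg_normed _)]
  rw [(shrinkingBump E k).integral_normed, ENNReal.ofReal_one]

theorem norm_mollify_le {g : E → F} {C : ℝ} (hC : ∀ x, ‖g x‖ ≤ C) (k : ℕ) (x : E) :
    ‖mollify μ g k x‖ ≤ C := by
  have hi := (shrinkingBump E k).integrable_normed (μ := μ)
  calc ‖mollify μ g k x‖ ≤ ∫ t, (shrinkingBump E k).normed μ t * C ∂μ := by
        refine norm_integral_le_of_norm_le (hi.mul_const C) (Eventually.of_forall fun t => ?_)
        rw [lsmul_apply, norm_smul, Real.norm_of_nonneg ((shrinkingBump E k).nonneg_normed _)]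
        exact mul_le_mul_of_nonneg_left (hC _) ((shrinkingBump E k).nonneg_normed _)
    _ = C := by rw [integral_mul_const, (shrinkingBump E k).integral_normed, one_mul]

theorem lintegral_enorm_mollify_le {g : E → F} (hg : AEStronglyMeasurable g μ) (k : ℕ) :
    ∫⁻ x, ‖mollify μ g k x‖ₑ ∂μ ≤ ∫⁻ x, ‖g x‖ₑ ∂μ := by
  set φ := (shrinkingBump E k).normed μ
  have hφ : AEStronglyMeasurable φ μ := (shrinkingBump E k).continuous_normed.aestronglyMeasurable
  calc ∫⁻ x, ‖mollify μ g k x‖ₑ ∂μ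
      ≤ ∫⁻ x, ∫⁻ t, ‖lsmul ℝ ℝ (φ t) (g (x - t))‖ₑ ∂μ ∂μ :=
        lintegral_mono fun x => enorm_integral_le_lintegral_enorm _
    _ = ∫⁻ t, ∫⁻ x, ‖lsmul ℝ ℝ (φ t) (g (x - t))‖ₑ ∂μ ∂μ :=
        lintegral_lintegral_swap (hφ.convolution_integrand (lsmul ℝ ℝ) hg).enorm
    _ = ∫⁻ t, ‖φ t‖ₑ * ∫⁻ x, ‖g x‖ₑ ∂μ ∂μ := by
        refine lintegral_congr fun t => ?_
        simp_rw [lsmul_apply, enorm_smul]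
        rw [lintegral_const_mul' _ _ enorm_ne_top, lintegral_sub_right_eq_self (fun x => ‖g x‖ₑ)]
    _ = ∫⁻ x, ‖g x‖ₑ ∂μ := by
        rw [lintegral_mul_const'' _ hφ.enorm, lintegral_enorm_shrinkingBump, one_mul]

theorem mollify_eq_zero_of_notMem_cthickening {g : E → F} {K : Set E}
    (hK : ∀ x ∉ K, g x = 0) {k : ℕ} {x : E}
    (hx : x ∉ cthickening (shrinkingBump E k).rOut K) : mollify μ g k x = 0 := by
  have hzero : ∀ y ∈ ball x (shrinkingBump E k).rOut, g y = 0 := by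
    intro y hy
    by_contra hne
    have hyK : y ∈ K := by_contra fun h => hne (hK y h)
    exact hx (mem_cthickening_of_dist_le x y _ _ hyK (by rw [dist_comm]; exact (mem_ball.1 hy).le))
  have hgx := hzero x (mem_ball_self (shrinkingBump E k).rOut_pos)
  rw [← hgx]
  exact ContDiffBump.normed_convolution_eq_right fun y hy => by rw [hzero y hy, hgx]

theorem tendsto_lintegral_enorm_mollify_sub_of_continuous {h : E → F} (hh : Continuous h)
    (hs : HasCompactSupport h) :
    Tendsto (fun k => ∫⁻ x, ‖mollify μ h k x - h x‖ₑ ∂μ) atTop (𝓝 0) := by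
  obtain ⟨M, hM⟩ := hh.bounded_above_of_compact_support hs
  have hK : IsCompact (cthickening 1 (tsupport h)) := hs.isCompact.cthickening
  have hz : ∀ x ∉ tsupport h, h x = 0 := fun x hx => image_eq_zero_of_notMem_tsupport hx
  have hlim : Tendsto (fun k => ∫⁻ x, ‖mollify μ h k x - h x‖ₑ ∂μ) atTop
      (𝓝 (∫⁻ _, 0 ∂μ)) := by
    refine tendsto_lintegral_of_dominated_convergence
      ((cthickening 1 (tsupport h)).indicator fun _ => ENNReal.ofReal (M + M))
      (fun k => ?_) (fun k => Eventually.of_forall fun x => ?_) ?_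
      (Eventually.of_forall fun x => ?_)
    · exact (((contDiff_mollify hh.locallyIntegrable 0 k).continuous).sub hh).enorm.measurable
    · beta_reduce
      by_cases hx : x ∈ cthickening 1 (tsupport h)
      · rw [indicator_of_mem hx, ← ofReal_norm]
        exact ENNReal.ofReal_le_ofReal
          ((norm_sub_le _ _).trans (add_le_add (norm_mollify_le hM k x) (hM x)))
      · rw [indicator_of_notMem hx, mollify_eq_zero_of_notMem_cthickening hz
          (fun hc => hx (cthickening_mono (rOut_shrinkingBump_le_one k) _ hc)),
          hz x (fun hc => hx (self_subset_cthickening _ hc))]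
        simp
    · rw [lintegral_indicator hK.measurableSet, setLIntegral_const]
      exact ENNReal.mul_ne_top ENNReal.ofReal_ne_top hK.measure_lt_top.ne
    · have := ((tendsto_mollify_of_continuous (μ := μ) hh x).sub_const (h x)).enorm
      simpa using this
  simpa using hlim

theorem mollify_sub {g h : E → F} (hg : LocallyIntegrable g μ) (hh : LocallyIntegrable h μ)
    (k : ℕ) (x : E) : mollify μ (fun y => g y - h y) k x = mollify μ g k x - mollify μ h k x := by
  have key : ∀ f : E → F, LocallyIntegrable f μ →
      Integrable (fun t => (shrinkingBump E k).normed μ t • f (x - t)) μ := fun f hf =>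
    (shrinkingBump E k).hasCompactSupport_normed.convolutionExists_left (lsmul ℝ ℝ)
      (shrinkingBump E k).continuous_normed hf x
  simp only [mollify, convolution_lsmul, smul_sub]
  exact integral_sub (key g hg) (key h hh)

/-- Mollifications of an integrable function converge to it in `L¹`. -/
theorem tendsto_lintegral_enorm_mollify_sub {g : E → F} (hg : Integrable g μ) :
    Tendsto (fun k => ∫⁻ x, ‖mollify μ g k x - g x‖ₑ ∂μ) atTop (𝓝 0) := by
  rw [ENNReal.tendsto_atTop_zero]
  intro ε hε
  have hε3 : ε / 3 ≠ 0 := (ENNReal.div_pos hε.ne' (by simp)).ne'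
  -- Density of compactly supported continuous functions, combined with the `L¹` contractivity of
  -- mollification.
  obtain ⟨h, hs, hle, hh, hhi⟩ := hg.exists_hasCompactSupport_lintegral_sub_le hε3
  obtain ⟨N, hN⟩ := ENNReal.tendsto_atTop_zero.1
    (tendsto_lintegral_enorm_mollify_sub_of_continuous (μ := μ) hh hs) (ε / 3)
    (pos_iff_ne_zero.2 hε3)
  refine ⟨N, fun k hk => ?_⟩
  have hmeas : ∀ {f : E → F}, LocallyIntegrable f μ → AEStronglyMeasurable (mollify μ f k) μ :=
    fun hf => (contDiff_mollify hf 0 k).continuous.aestronglyMeasurable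
  have hgh : Integrable (fun y => g y - h y) μ := hg.sub hhi
  calc ∫⁻ x, ‖mollify μ g k x - g x‖ₑ ∂μ
      ≤ ∫⁻ x, (‖mollify μ (fun y => g y - h y) k x‖ₑ + ‖mollify μ h k x - h x‖ₑ
          + ‖g x - h x‖ₑ) ∂μ := by
        refine lintegral_mono fun x => ?_
        rw [mollify_sub hg.locallyIntegrable hhi.locallyIntegrable]
        calc ‖mollify μ g k x - g x‖ₑ
            = ‖((mollify μ g k x - mollify μ h k x) + (mollify μ h k x - h x))
                - (g x - h x)‖ₑ := by congr 1; abel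
          _ ≤ _ := enorm_sub_le.trans (add_le_add_left (enorm_add_le _ _) _)
    _ = ∫⁻ x, ‖mollify μ (fun y => g y - h y) k x‖ₑ ∂μ + ∫⁻ x, ‖mollify μ h k x - h x‖ₑ ∂μ
          + ∫⁻ x, ‖g x - h x‖ₑ ∂μ := by
        rw [lintegral_add_right' _ hgh.aestronglyMeasurable.enorm,
          lintegral_add_left' (hmeas hgh.locallyIntegrable).enorm]
    _ ≤ ε / 3 + ε / 3 + ε / 3 := by
        gcongr
        · exact (lintegral_enorm_mollify_le hgh.aestronglyMeasurable k).trans hle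
        · exact hN k hk
    _ = ε := ENNReal.add_thirds ε

variable (μ) in
/-- `g` is the distributional derivative of `u` on the whole space. -/
def HasWeakFDeriv (u : E → F) (g : E → E →L[ℝ] F) : Prop :=
  ∀ φ : E → ℝ, ContDiff ℝ ∞ φ → HasCompactSupport φ → ∀ w : E,
    ∫ x, fderiv ℝ φ x w • u x ∂μ = - ∫ x, φ x • g x w ∂μ

/-- The derivative of a mollification is the mollification of the weak derivative. -/
theorem HasWeakFDeriv.hasFDerivAt_mollify {u : E → F} {g : E → E →L[ℝ] F}
    (h : HasWeakFDeriv μ u g) (hu : LocallyIntegrable u μ) (hg : LocallyIntegrable g μ)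
    (k : ℕ) (x : E) : HasFDerivAt (mollify μ u k) (mollify μ g k x) x := by
  set φ := (shrinkingBump E k).normed μ with hφ
  have hφs : HasCompactSupport φ := (shrinkingBump E k).hasCompactSupport_normed
  have hφc : ContDiff ℝ ∞ φ := (shrinkingBump E k).contDiff_normed
  have hφ1 : ContDiff ℝ 1 φ := (shrinkingBump E k).contDiff_normed
  suffices hD : mollify μ g k x = (fderiv ℝ φ ⋆[(lsmul ℝ ℝ).precompL E, μ] u) x by
    rw [hD]
    exact hφs.hasFDerivAt_convolution_left (lsmul ℝ ℝ) hφ1 hu x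
  ext w
  have e1 : mollify μ g k x w = ∫ t, φ (x - t) • g t w ∂μ := by
    change (φ ⋆[lsmul ℝ ℝ, μ] g) x w = _
    rw [convolution_eq_swap, ContinuousLinearMap.integral_apply]
    · rfl
    · have := hφs.convolutionExists_left (lsmul ℝ ℝ) hφc.continuous hg x
      exact convolutionExistsAt_iff_integrable_swap.1 this
  have e2 : (fderiv ℝ φ ⋆[(lsmul ℝ ℝ).precompL E, μ] u) x w =
      ∫ t, fderiv ℝ φ (x - t) w • u t ∂μ := by
    rw [convolution_eq_swap, ContinuousLinearMap.integral_apply]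
    · rfl
    · have := (hφs.fderiv ℝ).convolutionExists_left ((lsmul ℝ ℝ).precompL E)
        (hφ1.continuous_fderiv one_ne_zero) hu x
      exact convolutionExistsAt_iff_integrable_swap.1 this
  rw [e1, e2]
  -- Test against the reflected kernel; the sign from the reflection cancels the one in the
  -- definition of the weak derivative.
  have hψ := h (fun t => φ (x - t)) (hφc.comp (contDiff_const.sub contDiff_id))
    (hφs.comp_homeomorph (Homeomorph.subLeft x)) w
  have hd : ∀ t, fderiv ℝ (fun t => φ (x - t)) t w = - fderiv ℝ φ (x - t) w := by
    intro t
    have h1 : HasFDerivAt (fun t => x - t) (-ContinuousLinearMap.id ℝ E) t := by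
      simpa using (hasFDerivAt_id t).const_sub x
    have := ((hφ1.differentiable one_ne_zero (x - t)).hasFDerivAt).comp t h1
    rw [show (fun t => φ (x - t)) = φ ∘ fun t => x - t from rfl, this.fderiv]
    simp
  simp_rw [hd, neg_smul, integral_neg, neg_inj] at hψ
  exact hψ.symm

theorem tendsto_integral_smul_of_tendsto_lintegral {α : Type*} [MeasurableSpace α] {ν : Measure α}
    {a : α → ℝ} (ha : AEStronglyMeasurable a ν) {C : ℝ} (hC : ∀ x, ‖a x‖ ≤ C)
    {v : ℕ → α → F} {u : α → F} (hv : ∀ k, Integrable (v k) ν) (hu : Integrable u ν)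
    (h : Tendsto (fun k => ∫⁻ x, ‖v k x - u x‖ₑ ∂ν) atTop (𝓝 0)) :
    Tendsto (fun k => ∫ x, a x • v k x ∂ν) atTop (𝓝 (∫ x, a x • u x ∂ν)) := by
  have hi : ∀ {w : α → F}, Integrable w ν → Integrable (fun x => a x • w x) ν := fun hw =>
    hw.bdd_smul C ha (Eventually.of_forall hC)
  refine tendsto_integral_of_L1 _ (hi hu).aestronglyMeasurable
    (Eventually.of_forall fun k => hi (hv k)) ?_
  have h2 : Tendsto (fun k => ENNReal.ofReal C * ∫⁻ x, ‖v k x - u x‖ₑ ∂ν) atTop (𝓝 0) := by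
    simpa using ENNReal.Tendsto.const_mul h (Or.inr ENNReal.ofReal_ne_top)
  refine tendsto_of_tendsto_of_tendsto_of_le_of_le tendsto_const_nhds h2 (fun _ => zero_le)
    fun k => ?_
  rw [← lintegral_const_mul' _ _ ENNReal.ofReal_ne_top]
  refine lintegral_mono fun x => ?_
  rw [← smul_sub, enorm_smul, ← ofReal_norm (a x)]
  gcongr
  exact hC x

/-- The variation is defined with `C¹` fields, the weak derivative with smooth test functions; this
bridges the two. Mollifying `u` rather than `φ` reduces to classical integration by parts, and both
sides pass to the limit in `L¹`. -/
theorem HasWeakFDeriv.integral_fderiv_smul_eq_of_contDiff_one {u : E → F} {g : E → E →L[ℝ] F}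
    (h : HasWeakFDeriv μ u g) (hu : Integrable u μ) (hg : Integrable g μ)
    {φ : E → ℝ} (hφ : ContDiff ℝ 1 φ) (hφs : HasCompactSupport φ) (w : E) :
    ∫ x, fderiv ℝ φ x w • u x ∂μ = - ∫ x, φ x • g x w ∂μ := by
  have hv : ∀ k, ContDiff ℝ 1 (mollify μ u k) := contDiff_mollify hu.locallyIntegrable 1
  have hvi : ∀ k, Integrable (mollify μ u k) μ := fun k =>
    ⟨(hv k).continuous.aestronglyMeasurable,
      (lintegral_enorm_mollify_le hu.aestronglyMeasurable k).trans_lt hu.hasFiniteIntegral⟩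
  have hgi : ∀ k, Integrable (mollify μ g k) μ := fun k =>
    ⟨(contDiff_mollify hg.locallyIntegrable 0 k).continuous.aestronglyMeasurable,
      (lintegral_enorm_mollify_le hg.aestronglyMeasurable k).trans_lt hg.hasFiniteIntegral⟩
  have hd : ∀ k, fderiv ℝ (mollify μ u k) = mollify μ g k := fun k => funext fun x =>
    (h.hasFDerivAt_mollify hu.locallyIntegrable hg.locallyIntegrable k x).fderiv
  have hφ' : Continuous fun x => fderiv ℝ φ x w :=
    (hφ.continuous_fderiv one_ne_zero).clm_apply continuous_const
  have hφ's : HasCompactSupport fun x => fderiv ℝ φ x w := hφs.fderiv_apply ℝ w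
  obtain ⟨C, hC⟩ := hφ.continuous.bounded_above_of_compact_support hφs
  obtain ⟨C', hC'⟩ := hφ'.bounded_above_of_compact_support hφ's
  have hk : ∀ k, ∫ x, fderiv ℝ φ x w • mollify μ u k x ∂μ =
      - ∫ x, φ x • mollify μ g k x w ∂μ := by
    intro k
    have := integral_smul_fderiv_eq_neg_fderiv_smul_of_integrable (μ := μ) (f := φ)
      (g := mollify μ u k) (v := w)
      ((hvi k).bdd_smul C' hφ'.aestronglyMeasurable (Eventually.of_forall hC'))
      (by
        rw [hd]
        exact ((hgi k).apply_continuousLinearMap w).bdd_smul C hφ.continuous.aestronglyMeasurable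
          (Eventually.of_forall hC))
      ((hvi k).bdd_smul C hφ.continuous.aestronglyMeasurable (Eventually.of_forall hC))
      (fun x _ => hφ.differentiable one_ne_zero x)
      (fun x _ => (hv k).differentiable one_ne_zero x)
    rw [hd] at this
    rw [this, neg_neg]
  have l1 := tendsto_integral_smul_of_tendsto_lintegral hφ'.aestronglyMeasurable hC' hvi hu
    (tendsto_lintegral_enorm_mollify_sub hu)
  have l2 := (tendsto_integral_smul_of_tendsto_lintegral hφ.continuous.aestronglyMeasurable hC
    hgi hg (tendsto_lintegral_enorm_mollify_sub hg))
  have l3 := (((ContinuousLinearMap.apply ℝ F w).continuous.tendsto _).comp l2).neg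
  have e : ∀ {G : E → E →L[ℝ] F}, Integrable G μ →
      (ContinuousLinearMap.apply ℝ F w) (∫ x, φ x • G x ∂μ) = ∫ x, φ x • G x w ∂μ := by
    intro G hG
    have hi : Integrable (fun x => φ x • G x) μ :=
      hG.bdd_smul C hφ.continuous.aestronglyMeasurable (Eventually.of_forall hC)
    rw [ContinuousLinearMap.apply_apply, ContinuousLinearMap.integral_apply hi]
    rfl
  rw [e hg] at l3
  refine tendsto_nhds_unique (l1.congr hk) (l3.congr fun k => ?_)
  rw [Function.comp_apply, e (hgi k)]

end Mollification

/-! ### Differentiability on large sets -/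

section ApproximateDifferentiability

open Metric Filter Topology

variable {E F : Type*} [NormedAddCommGroup E] [NormedSpace ℝ E] [FiniteDimensional ℝ E]
  [MeasurableSpace E] [BorelSpace E] {μ : Measure E} [μ.IsAddHaarMeasure]
  [NormedAddCommGroup F] [NormedSpace ℝ F] [CompleteSpace F]

/-- Summing the increments, `u - v k` varies between `x` and `y ∈ A` by at most `2 * C * (1 / 2) ^ k
* ‖y - x‖`. Fixing one large `k`, this error, the Taylor remainder of `v k` and the error in the
derivative each take `ε / 3`. -/
theorem hasFDerivWithinAt_of_geometric_increments {v : ℕ → E → F} {u : E → F} {D : E →L[ℝ] F}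
    {A : Set E} {x : E} {C : ℝ} (hv : ∀ k, DifferentiableAt ℝ (v k) x)
    (hlim : ∀ y, Tendsto (fun k => v k y) atTop (𝓝 (u y)))
    (hD : Tendsto (fun k => fderiv ℝ (v k) x) atTop (𝓝 D))
    (hinc : ∀ y ∈ A, dist y x ≤ 1 → ∀ k,
      ‖(v (k + 1) y - v k y) - (v (k + 1) x - v k x)‖ ≤ C * ‖y - x‖ * (1 / 2) ^ k) :
    HasFDerivWithinAt u D A x := by
  rw [hasFDerivWithinAt_iff_isLittleO, Asymptotics.isLittleO_iff]
  intro ε hε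
  have h1 : Tendsto (fun k : ℕ => C * (1 / 2 : ℝ) ^ k / (1 - 1 / 2)) atTop (𝓝 0) := by
    have := ((tendsto_pow_atTop_nhds_zero_of_lt_one (r := (1 / 2 : ℝ)) (by norm_num)
      (by norm_num)).const_mul C).div_const (1 - 1 / 2)
    simpa using this
  have h2 : Tendsto (fun k => ‖fderiv ℝ (v k) x - D‖) atTop (𝓝 0) := by
    have := (hD.sub_const D).norm
    simpa using this
  obtain ⟨k, hk1, hk2⟩ := ((h1.eventually (gt_mem_nhds (by positivity : 0 < ε / 3))).and
    (h2.eventually (gt_mem_nhds (by positivity : 0 < ε / 3)))).exists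
  have h3 := (Asymptotics.isLittleO_iff.1 (hasFDerivAt_iff_isLittleO.1 (hv k).hasFDerivAt))
    (by positivity : 0 < ε / 3)
  filter_upwards [mem_nhdsWithin_of_mem_nhds h3, self_mem_nhdsWithin,
    mem_nhdsWithin_of_mem_nhds (closedBall_mem_nhds x one_pos)] with y hy hyA hy1
  have h4 : dist (v k y - v k x) (u y - u x) ≤ C * ‖y - x‖ * (1 / 2) ^ k / (1 - 1 / 2) := by
    refine dist_le_of_le_geometric_of_tendsto (1 / 2 : ℝ) (C * ‖y - x‖) (by norm_num)
      (f := fun k => v k y - v k x) (fun j => ?_) ((hlim y).sub (hlim x)) k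
    rw [dist_comm, dist_eq_norm]
    calc _ = ‖(v (j + 1) y - v j y) - (v (j + 1) x - v j x)‖ := by congr 1; abel
      _ ≤ _ := hinc y hyA hy1 j
  rw [dist_comm, dist_eq_norm] at h4
  calc ‖u y - u x - D (y - x)‖
      = ‖(u y - u x - (v k y - v k x)) + (v k y - v k x - fderiv ℝ (v k) x (y - x))
          + (fderiv ℝ (v k) x - D) (y - x)‖ := by
        congr 1; rw [sub_apply]; abel
    _ ≤ ‖u y - u x - (v k y - v k x)‖ + ‖v k y - v k x - fderiv ℝ (v k) x (y - x)‖
          + ‖(fderiv ℝ (v k) x - D) (y - x)‖ := norm_add₃_le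
    _ ≤ C * (1 / 2) ^ k / (1 - 1 / 2) * ‖y - x‖ + ε / 3 * ‖y - x‖ + ε / 3 * ‖y - x‖ := by
        gcongr
        · refine h4.trans_eq ?_
          ring
        · exact (ContinuousLinearMap.le_opNorm _ _).trans (by gcongr)
    _ ≤ ε / 3 * ‖y - x‖ + ε / 3 * ‖y - x‖ + ε / 3 * ‖y - x‖ := by gcongr
    _ = ε * ‖y - x‖ := by ring

/-- Almost all of the space is covered by countably many measurable sets relative to which a
continuous `W^{1,1}` function is differentiable, with its weak derivative as derivative. -/
theorem HasWeakFDeriv.exists_hasFDerivWithinAt {u : E → F} {g : E → E →L[ℝ] F}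
    (h : HasWeakFDeriv μ u g) (hu : Continuous u) (hg : Integrable g μ) :
    ∃ A : ℕ → Set E, (∀ m, MeasurableSet (A m)) ∧ μ (⋃ m, A m)ᶜ = 0 ∧
      ∀ m, ∀ x ∈ A m, HasFDerivWithinAt u (g x) (A m) x := by
  set N := Module.finrank ℝ E
  -- The rate `4⁻¹ ^ k` is divided by the height `2⁻¹ ^ k` in the weak type inequality, which still
  -- leaves a summable `2⁻¹ ^ k` for the bad sets.
  obtain ⟨n, hn, hnle⟩ := extraction_forall_of_eventually (P := fun k j =>
      ∫⁻ x, ‖mollify μ g j x - g x‖ₑ ∂μ ≤ (4⁻¹ : ℝ≥0∞) ^ k) fun k =>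
    ((tendsto_lintegral_enorm_mollify_sub hg).eventually
      (gt_mem_nhds (ENNReal.pow_pos (by simp) k))).mono fun j hj => le_of_lt hj
  set v : ℕ → E → F := fun k => mollify μ u (n k)
  set G : ℕ → E → E →L[ℝ] F := fun k => mollify μ g (n k)
  have hul : LocallyIntegrable u μ := hu.locallyIntegrable
  have hv : ∀ k, ContDiff ℝ 1 (v k) := fun k => contDiff_mollify hul 1 (n k)
  have hG : ∀ k, Continuous (G k) := fun k =>
    (contDiff_mollify hg.locallyIntegrable 0 (n k)).continuous
  have hvG : ∀ k x, HasFDerivAt (v k) (G k x) x := fun k x =>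
    h.hasFDerivAt_mollify hul hg.locallyIntegrable (n k) x
  set c : ℕ → ℝ≥0∞ := fun k => (2⁻¹ : ℝ≥0∞) ^ k
  set bad : ℕ → Set E := fun k =>
    maximalSuperlevel μ (fun y => ‖fderiv ℝ (fun z => v (k + 1) z - v k z) y‖ₑ) (c k)
  have hbad : ∀ k, μ (bad k) ≤ 5 ^ N * 2 * (2⁻¹ : ℝ≥0∞) ^ k := by
    intro k
    have hint : ∫⁻ y, ‖fderiv ℝ (fun z => v (k + 1) z - v k z) y‖ₑ ∂μ ≤
        2 * (4⁻¹ : ℝ≥0∞) ^ k := by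
      calc ∫⁻ y, ‖fderiv ℝ (fun z => v (k + 1) z - v k z) y‖ₑ ∂μ
          ≤ ∫⁻ y, (‖G (k + 1) y - g y‖ₑ + ‖G k y - g y‖ₑ) ∂μ := by
            refine lintegral_mono fun y => ?_
            beta_reduce
            rw [((hvG (k + 1) y).fun_sub (hvG k y)).fderiv]
            calc ‖G (k + 1) y - G k y‖ₑ = ‖(G (k + 1) y - g y) - (G k y - g y)‖ₑ := by
                  congr 1; abel
              _ ≤ _ := enorm_sub_le
        _ = ∫⁻ y, ‖G (k + 1) y - g y‖ₑ ∂μ + ∫⁻ y, ‖G k y - g y‖ₑ ∂μ :=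
            lintegral_add_left' ((hG (k + 1)).aestronglyMeasurable.sub
              hg.aestronglyMeasurable).enorm _
        _ ≤ (4⁻¹ : ℝ≥0∞) ^ (k + 1) + (4⁻¹ : ℝ≥0∞) ^ k := add_le_add (hnle (k + 1)) (hnle k)
        _ ≤ (4⁻¹ : ℝ≥0∞) ^ k + (4⁻¹ : ℝ≥0∞) ^ k := by
            gcongr ?_ + _
            exact pow_le_pow_of_le_one zero_le (by simp) (Nat.le_succ k)
        _ = _ := (two_mul _).symm
    have h1 := mul_measure_maximalSuperlevel_le μ
      (fun y => ‖fderiv ℝ (fun z => v (k + 1) z - v k z) y‖ₑ) (c k)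
    have h2 : c k * μ (bad k) ≤ c k * (5 ^ N * 2 * (2⁻¹ : ℝ≥0∞) ^ k) := by
      refine h1.trans ((mul_le_mul_right hint _).trans_eq ?_)
      have : (4⁻¹ : ℝ≥0∞) ^ k = 2⁻¹ ^ k * 2⁻¹ ^ k := by
        rw [← mul_pow, ← ENNReal.mul_inv (by simp) (by simp)]
        norm_num
      rw [this]
      ring
    exact (ENNReal.mul_le_mul_iff_right (by simp [c]) (by simp [c])).1 h2
  -- Measurable hulls keep the pieces measurable without any claim on the superlevel sets
  -- themselves.
  set T : ℕ → Set E := fun k => toMeasurable μ (bad k)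
  have hsum : ∑' k, μ (T k) ≠ ⊤ := by
    refine ne_top_of_le_ne_top ?_
      (ENNReal.tsum_le_tsum fun k => (measure_toMeasurable (bad k)).trans_le (hbad k))
    rw [ENNReal.tsum_mul_left, ENNReal.tsum_geometric]
    exact ENNReal.mul_ne_top (ENNReal.mul_ne_top (by simp) (by simp)) (by simp)
  have hae : μ {x | ¬ Tendsto (fun k => G k x) atTop (𝓝 (g x))} = 0 :=
    (ae_tendsto_mollify hg.locallyIntegrable).mono fun x hx => hx.comp hn.tendsto_atTop
  set Z := toMeasurable μ {x | ¬ Tendsto (fun k => G k x) atTop (𝓝 (g x))}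
  -- The `m`-th piece avoids all bad sets from index `m` on, and the points where the mollified
  -- derivatives fail to converge. By Borel–Cantelli almost every point lies in some piece.
  refine ⟨fun m => (⋂ k, (T (m + k))ᶜ) \ Z, fun m => ?_, ?_, fun m x hx => ?_⟩
  · exact (MeasurableSet.iInter fun k => (measurableSet_toMeasurable _ _).compl).diff
      (measurableSet_toMeasurable _ _)
  · have hZ : ∀ᵐ x ∂μ, x ∉ Z := by
      rw [← measure_toMeasurable] at hae
      exact measure_eq_zero_iff_ae_notMem.1 hae
    change ∀ᵐ x ∂μ, x ∈ ⋃ m, (⋂ k, (T (m + k))ᶜ) \ Z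
    filter_upwards [ae_eventually_notMem hsum, hZ] with x hx hxZ
    obtain ⟨m, hm⟩ := eventually_atTop.1 hx
    exact mem_iUnion.2 ⟨m, mem_iInter.2 fun k => hm _ (Nat.le_add_right m k), hxZ⟩
  · have htend : Tendsto (fun k => G k x) atTop (𝓝 (g x)) := by
      by_contra hc
      exact hx.2 (subset_toMeasurable _ _ hc)
    have hnot : ∀ y ∈ (⋂ k, (T (m + k))ᶜ) \ Z, ∀ k, y ∉ bad (m + k) := fun y hy k hyk =>
      mem_iInter.1 hy.1 k (subset_toMeasurable _ _ hyk)
    have hshift : Tendsto (fun k => m + k) atTop atTop :=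
      tendsto_atTop_mono (Nat.le_add_left · m) tendsto_id
    refine hasFDerivWithinAt_of_geometric_increments (v := fun k => v (m + k))
      (C := 2 ^ (N + 1) * (1 / 2) ^ m)
      (fun k => (hvG (m + k) x).differentiableAt)
      (fun y => (tendsto_mollify_of_continuous hu y).comp (hn.tendsto_atTop.comp hshift)) ?_
      fun y hy hyx k => ?_
    · simp_rw [fun k => (hvG (m + k) x).fderiv]
      exact htend.comp hshift
    · have h1 := enorm_sub_le_of_notMem_maximalSuperlevel μ
        ((hv (m + k + 1)).sub (hv (m + k))) (hnot x hx k) (hnot y hy k) hyx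
      have h2 := ENNReal.toReal_mono (by
        refine ENNReal.mul_ne_top (ENNReal.mul_ne_top (by simp) ?_) enorm_ne_top
        simp [c]) h1
      simp only [toReal_enorm, ENNReal.toReal_mul, ENNReal.toReal_pow, ENNReal.toReal_ofNat, c,
        ENNReal.toReal_inv] at h2
      refine h2.trans_eq ?_
      rw [pow_add]
      simp only [one_div]
      ring

end ApproximateDifferentiability

/-! ### Localization to compact subsets of the domain -/

section Localization

open Metric Filter Topology

theorem MeasureTheory.Integrable.add_of_normed {X G : Type*} [MeasurableSpace X] {μ : Measure X}
    [NormedAddCommGroup G] {a b : X → G} (ha : Integrable a μ) (hb : Integrable b μ) :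
    Integrable (fun x => a x + b x) μ :=
  ha.add hb

theorem MeasureTheory.LocallyIntegrableOn.sum_smul_const {X G ι : Type*} [TopologicalSpace X]
    [MeasurableSpace X] {μ : Measure X} [NormedAddCommGroup G] [NormedSpace ℝ G] [Fintype ι]
    {s : Set X} {a : ι → X → ℝ} (ha : ∀ i, LocallyIntegrableOn (a i) s μ) (v : ι → G) :
    LocallyIntegrableOn (fun x => ∑ i, a i x • v i) s μ := by
  intro x hx
  choose t ht hi using fun i => ha i x hx
  exact ⟨⋂ i, t i, iInter_mem.2 ht, integrable_finsetSum _ fun i _ =>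
    Integrable.smul_const ((hi i).mono_set (iInter_subset t i)) (v i)⟩

theorem MeasureTheory.LocallyIntegrableOn.integrable_smul_of_tsupport_subset {X G : Type*}
    [TopologicalSpace X] [T2Space X] [MeasurableSpace X] [OpensMeasurableSpace X] {μ : Measure X}
    [NormedAddCommGroup G] [NormedSpace ℝ G] {Ω : Set X} {h : X → G}
    (hh : LocallyIntegrableOn h Ω μ) {η : X → ℝ} (hη : Continuous η) (hs : HasCompactSupport η)
    (hΩ : tsupport η ⊆ Ω) : Integrable (fun x => η x • h x) μ := by
  have h1 : IntegrableOn (fun x => η x • h x) (tsupport η) μ :=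
    (hh.integrableOn_compact_subset hΩ hs.isCompact).continuousOn_smul hη.continuousOn hs.isCompact
  exact h1.integrable_of_forall_notMem_eq_zero fun x hx => by
    rw [image_eq_zero_of_notMem_tsupport hx, zero_smul]

variable {n d : ℕ}

/-- The linear map `ℝⁿ → ℝᵈ` given by a `d × n` matrix. -/
noncomputable def matrixCLM : Matrix (Fin d) (Fin n) ℝ →ₗ[ℝ] Rn n →L[ℝ] Rn d :=
  (LinearMap.toContinuousLinearMap (𝕜 := ℝ) (E := Rn n) (F' := Rn d)).toLinearMap ∘ₗ
    (Matrix.toEuclideanLin (𝕜 := ℝ) (m := Fin d) (n := Fin n)).toLinearMap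

theorem matrixCLM_apply (A : Matrix (Fin d) (Fin n) ℝ) (w : Rn n) (i : Fin d) :
    matrixCLM A w i = ∑ j, A i j * w j := by
  change (A.mulVec w.ofLp) i = _
  rfl

theorem matrixCLM_eq_sum (A : Matrix (Fin d) (Fin n) ℝ) :
    matrixCLM A = ∑ i, ∑ j, A i j • matrixCLM (Matrix.single i j (1 : ℝ)) := by
  conv_lhs => rw [Matrix.matrix_eq_sum_single A]
  simp only [map_sum]
  refine Finset.sum_congr rfl fun i _ => Finset.sum_congr rfl fun j _ => ?_
  rw [← map_smul, Matrix.smul_single, smul_eq_mul, mul_one]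

theorem det_matrixCLM (A : Matrix (Fin n) (Fin n) ℝ) : (matrixCLM A).det = A.det := by
  change LinearMap.det (Matrix.toLpLin 2 2 A) = A.det
  rw [Matrix.toLpLin_eq_toLin, LinearMap.det_toLin]

theorem fderiv_apply_eq_sum_partialDeriv (φ : Rn n → ℝ) (x w : Rn n) :
    fderiv ℝ φ x w = ∑ j, w j * partialDeriv j φ x := by
  have hw : w = ∑ j, w j • EuclideanSpace.single j (1 : ℝ) := by
    ext i
    simp [Finset.sum_apply, Pi.single_apply]
  conv_lhs => rw [hw]
  simp [map_sum, partialDeriv]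

/-- The derivative vanishes at every point of `K` because `η ≤ 1` attains its maximum there. Thus
the product rule adds no term on `K`, even at boundary points. -/
theorem exists_contDiff_cutoff {K Ω : Set (Rn n)} (hK : IsCompact K) (hΩ : IsOpen Ω)
    (hKΩ : K ⊆ Ω) :
    ∃ η : Rn n → ℝ, ContDiff ℝ ∞ η ∧ HasCompactSupport η ∧ tsupport η ⊆ Ω ∧
      ∀ x ∈ K, η x = 1 ∧ fderiv ℝ η x = 0 := by
  obtain ⟨L, hL, hKL, hLΩ⟩ := exists_compact_between hK hΩ hKΩ
  obtain ⟨η, hη, hr, hsupp, hone⟩ := exists_contMDiff_support_eq_eq_one_iff (n := ⊤)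
    (modelWithCornersSelf ℝ (Rn n)) isOpen_interior hK.isClosed hKL
  have hts : tsupport η ⊆ L := by
    rw [tsupport, hsupp]
    exact hL.isClosed.closure_interior_subset
  refine ⟨η, hη.contDiff, hL.of_isClosed_subset (isClosed_tsupport η) hts, hts.trans hLΩ,
    fun x hx => ⟨(hone x).1 hx, IsLocalMax.fderiv_eq_zero (Eventually.of_forall fun y => ?_)⟩⟩
  rw [(hone x).1 hx]
  exact (hr (mem_range_self y)).2

variable {Ω : Set (Rn n)} {f : Rn n → Rn d} {Df : Rn n → Matrix (Fin d) (Fin n) ℝ}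

theorem HasLocSobolevDeriv.locallyIntegrableOn_matrixCLM (h : HasLocSobolevDeriv Ω f Df) :
    LocallyIntegrableOn (fun x => matrixCLM (Df x)) Ω volume := by
  rw [funext fun x => matrixCLM_eq_sum (Df x)]
  simp_rw [← Fintype.sum_prod_type'
    (f := fun i j => Df _ i j • matrixCLM (Matrix.single i j (1 : ℝ)))]
  exact LocallyIntegrableOn.sum_smul_const (a := fun (p : Fin d × Fin n) x => Df x p.1 p.2)
    (fun p => h.locallyIntegrableOn_deriv p.1 p.2) _

theorem HasLocSobolevDeriv.integral_fderiv_mul (h : HasLocSobolevDeriv Ω f Df) {φ : Rn n → ℝ}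
    (hφ : ContDiff ℝ ∞ φ) (hs : HasCompactSupport φ) (hΩ : tsupport φ ⊆ Ω) (w : Rn n)
    (i : Fin d) :
    ∫ x, fderiv ℝ φ x w * f x i = - ∫ x, φ x * matrixCLM (Df x) w i := by
  have hpc : ∀ j, Continuous (partialDeriv j φ) := fun j =>
    (hφ.continuous_fderiv (by simp)).clm_apply continuous_const
  have hsub : ∀ j, tsupport (partialDeriv j φ) ⊆ tsupport φ := fun j =>
    tsupport_fderiv_apply_subset ℝ _
  have hps : ∀ j, HasCompactSupport (partialDeriv j φ) := fun j => hs.fderiv_apply ℝ _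
  have hfi : LocallyIntegrableOn (fun x => f x i) Ω volume := fun x hx => by
    obtain ⟨s, hs, hi⟩ := h.locallyIntegrableOn x hx
    exact ⟨s, hs, (EuclideanSpace.proj (𝕜 := ℝ) i).integrable_comp hi⟩
  have hj : ∀ j, ∫ x, partialDeriv j φ x * f x i = - ∫ x, φ x * Df x i j := by
    intro j
    have := h.integral_mul_partialDeriv i j φ hφ hs hΩ
    rw [setIntegral_eq_integral_of_forall_compl_eq_zero,
      setIntegral_eq_integral_of_forall_compl_eq_zero] at this
    · simpa only [mul_comm] using this
    · intro x hx
      rw [image_eq_zero_of_notMem_tsupport fun hc => hx (hΩ hc), mul_zero]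
    · intro x hx
      rw [image_eq_zero_of_notMem_tsupport fun hc => hx (hΩ (hsub j hc)), mul_zero]
  have i1 : ∀ j, Integrable (fun x => w j * (partialDeriv j φ x * f x i)) := fun j =>
    (hfi.integrable_smul_of_tsupport_subset (hpc j) (hps j) ((hsub j).trans hΩ)).const_mul _
  have i2 : ∀ j, Integrable (fun x => w j * (φ x * Df x i j)) := fun j =>
    ((h.locallyIntegrableOn_deriv i j).integrable_smul_of_tsupport_subset hφ.continuous hs
      hΩ).const_mul _
  calc ∫ x, fderiv ℝ φ x w * f x i = ∫ x, ∑ j, w j * (partialDeriv j φ x * f x i) := by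
        congr 1 with x
        rw [fderiv_apply_eq_sum_partialDeriv, Finset.sum_mul]
        simp only [mul_assoc]
    _ = ∑ j, w j * ∫ x, partialDeriv j φ x * f x i := by
        rw [integral_finsetSum _ fun j _ => i1 j]
        simp only [integral_const_mul]
    _ = - ∑ j, w j * ∫ x, φ x * Df x i j := by
        simp only [hj, mul_neg, Finset.sum_neg_distrib]
    _ = - ∫ x, ∑ j, w j * (φ x * Df x i j) := by
        rw [integral_finsetSum _ fun j _ => i2 j]
        simp only [integral_const_mul]
    _ = _ := by
        congr 2 with x
        rw [matrixCLM_apply, Finset.mul_sum]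
        exact Finset.sum_congr rfl fun j _ => by ring

/-- Near a compact subset of its domain, a continuous Sobolev map agrees with a compactly
supported one on the whole space. -/
theorem HasLocSobolevDeriv.exists_hasWeakFDeriv (h : HasLocSobolevDeriv Ω f Df) (hΩ : IsOpen Ω)
    (hf : ContinuousOn f Ω) {K : Set (Rn n)} (hK : IsCompact K) (hKΩ : K ⊆ Ω) :
    ∃ (u : Rn n → Rn d) (g : Rn n → Rn n →L[ℝ] Rn d), Continuous u ∧ HasCompactSupport u ∧
      Integrable g ∧ HasWeakFDeriv volume u g ∧
      ∀ x ∈ K, u x = f x ∧ g x = matrixCLM (Df x) := by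
  obtain ⟨η, hη, hs, hηΩ, hone⟩ := exists_contDiff_cutoff hK hΩ hKΩ
  have hη' : Continuous (fderiv ℝ η) := hη.continuous_fderiv (by simp)
  have hts : tsupport (fun x => η x • f x) ⊆ tsupport η :=
    closure_mono (Function.support_smul_subset_left η f)
  have hu : Continuous fun x => η x • f x := continuous_of_tsupport fun x hx =>
    hη.continuous.continuousAt.smul (hf.continuousAt (hΩ.mem_nhds (hηΩ (hts hx))))
  have hus : HasCompactSupport fun x => η x • f x := hs.smul_right
  have g1 : Integrable fun x => η x • matrixCLM (Df x) :=
    h.locallyIntegrableOn_matrixCLM.integrable_smul_of_tsupport_subset hη.continuous hs hηΩ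
  have hts2 : tsupport (fun x => (fderiv ℝ η x).smulRight (f x)) ⊆ tsupport η := by
    refine (closure_mono ?_).trans (tsupport_fderiv_subset ℝ (f := η))
    intro x hx hc
    exact hx (by simp [hc])
  have g2c : Continuous fun x => (fderiv ℝ η x).smulRight (f x) :=
    continuous_of_tsupport fun x hx =>
      (ContinuousLinearMap.smulRightL ℝ (Rn n) (Rn d)).continuous₂.continuousAt.comp₂
        hη'.continuousAt (hf.continuousAt (hΩ.mem_nhds (hηΩ (hts2 hx))))
  have g2 : Integrable fun x => (fderiv ℝ η x).smulRight (f x) :=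
    g2c.integrable_of_hasCompactSupport
      (hs.isCompact.of_isClosed_subset (isClosed_tsupport _) hts2)
  refine ⟨fun x => η x • f x, fun x => η x • matrixCLM (Df x) + (fderiv ℝ η x).smulRight (f x),
    hu, hus, g1.add_of_normed g2, fun φ hφ hφs w => ?_, fun x hx => ?_⟩
  · ext i
    have hφ'c : Continuous fun x => fderiv ℝ φ x w :=
      (hφ.continuous_fderiv (by simp)).clm_apply continuous_const
    have k1 : Integrable fun x => fderiv ℝ φ x w • (η x • f x) :=
      (hφ'c.smul hu).integrable_of_hasCompactSupport hus.smul_left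
    have k2 : Integrable fun x => φ x • (η x • matrixCLM (Df x)) w := by
      obtain ⟨C, hC⟩ := hφ.continuous.bounded_above_of_compact_support hφs
      exact (g1.apply_continuousLinearMap w).bdd_smul C hφ.continuous.aestronglyMeasurable
        (Eventually.of_forall hC)
    have k3 : Integrable fun x => φ x • ((fderiv ℝ η x).smulRight (f x)) w := by
      refine (hφ.continuous.smul (g2c.clm_apply continuous_const)).integrable_of_hasCompactSupport
        hφs.smul_right
    have k23 : Integrable fun x => φ x •
        (η x • matrixCLM (Df x) + (fderiv ℝ η x).smulRight (f x)) w := by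
      refine (k2.add k3).congr (Eventually.of_forall fun x => ?_)
      simp [smul_add]
    have hcomp : ∀ {G : Rn n → Rn d}, Integrable G → (∫ x, G x) i = ∫ x, G x i := fun hG =>
      ((EuclideanSpace.proj (𝕜 := ℝ) i).integral_comp_comm hG).symm
    rw [hcomp k1, PiLp.neg_apply, hcomp k23]
    -- Testing the local identity with `φ * η` gives the weak product rule for `η • f`.
    have hprod := h.integral_fderiv_mul (φ := fun x => φ x * η x) (hφ.mul hη) hs.mul_left
      ((closure_mono (Function.support_mul_subset_right φ η)).trans hηΩ) w i
    have hder : ∀ x, fderiv ℝ (fun x => φ x * η x) x w =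
        fderiv ℝ φ x w * η x + φ x * fderiv ℝ η x w := by
      intro x
      rw [fderiv_fun_mul (hφ.differentiable (by simp) x) (hη.differentiable (by simp) x)]
      simp
      ring
    have m1 : Integrable fun x => (fderiv ℝ φ x w • (η x • f x)) i :=
      (EuclideanSpace.proj (𝕜 := ℝ) i).integrable_comp k1
    have m2 : Integrable fun x => (φ x • (η x • matrixCLM (Df x)) w) i :=
      (EuclideanSpace.proj (𝕜 := ℝ) i).integrable_comp k2
    have m3 : Integrable fun x => (φ x • ((fderiv ℝ η x).smulRight (f x)) w) i :=
      (EuclideanSpace.proj (𝕜 := ℝ) i).integrable_comp k3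
    have s1 : ∫ x, fderiv ℝ (fun x => φ x * η x) x w * f x i =
        (∫ x, (fderiv ℝ φ x w • (η x • f x)) i) +
          ∫ x, (φ x • ((fderiv ℝ η x).smulRight (f x)) w) i := by
      rw [← integral_add m1 m3]
      congr 1 with x
      rw [hder]
      simp
      ring
    have s2 : ∫ x, (φ x • (η x • matrixCLM (Df x) + (fderiv ℝ η x).smulRight (f x)) w) i =
        (∫ x, φ x * η x * matrixCLM (Df x) w i) +
          ∫ x, (φ x • ((fderiv ℝ η x).smulRight (f x)) w) i := by
      have : ∫ x, φ x * η x * matrixCLM (Df x) w i =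
          ∫ x, (φ x • (η x • matrixCLM (Df x)) w) i := by
        congr 1 with x
        simp
        ring
      rw [this, ← integral_add m2 m3]
      congr 1 with x
      simp
    rw [s2]
    linarith
  · obtain ⟨h1, h2⟩ := hone x hx
    simp [h1, h2]

/-- Localize to the compact set `tsupport φ`, where the global `u` and `g` agree with `f` and `Df`;
elsewhere both integrands vanish. -/
theorem HasLocSobolevDeriv.integral_fderiv_mul_of_contDiff_one (h : HasLocSobolevDeriv Ω f Df)
    (hΩ : IsOpen Ω) (hf : ContinuousOn f Ω) {φ : Rn n → ℝ}
    (hφ : ContDiff ℝ 1 φ) (hs : HasCompactSupport φ) (hφΩ : tsupport φ ⊆ Ω) (i : Fin d)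
    (j : Fin n) :
    ∫ x, f x i * partialDeriv j φ x = - ∫ x, Df x i j * φ x := by
  obtain ⟨u, g, hu, hus, hg, hw, heq⟩ := h.exists_hasWeakFDeriv hΩ hf hs.isCompact hφΩ
  have hui : Integrable u := hu.integrable_of_hasCompactSupport hus
  have key := hw.integral_fderiv_smul_eq_of_contDiff_one hui hg hφ hs (EuclideanSpace.single j 1)
  have hφ'c : Continuous fun x => fderiv ℝ φ x (EuclideanSpace.single j 1) :=
    (hφ.continuous_fderiv one_ne_zero).clm_apply continuous_const
  have k1 : Integrable fun x => fderiv ℝ φ x (EuclideanSpace.single j 1) • u x :=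
    (hφ'c.smul hu).integrable_of_hasCompactSupport hus.smul_left
  have k2 : Integrable fun x => φ x • g x (EuclideanSpace.single j 1) := by
    obtain ⟨C, hC⟩ := hφ.continuous.bounded_above_of_compact_support hs
    exact (hg.apply_continuousLinearMap _).bdd_smul C hφ.continuous.aestronglyMeasurable
      (Eventually.of_forall hC)
  have hcomp : ∀ {G : Rn n → Rn d}, Integrable G → (∫ x, G x) i = ∫ x, G x i := fun hG =>
    ((EuclideanSpace.proj (𝕜 := ℝ) i).integral_comp_comm hG).symm
  have key2 := congrArg (fun v : Rn d => v i) key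
  simp only [PiLp.neg_apply] at key2
  rw [hcomp k1, hcomp k2] at key2
  convert key2 using 1
  · congr 1 with x
    by_cases hx : x ∈ tsupport φ
    · rw [(heq x hx).1, PiLp.smul_apply, smul_eq_mul, mul_comm]; rfl
    · have : fderiv ℝ φ x = 0 := image_eq_zero_of_notMem_tsupport
        fun hc => hx (tsupport_fderiv_subset ℝ hc)
      simp [partialDeriv, this]
  · congr 2 with x
    by_cases hx : x ∈ tsupport φ
    · rw [(heq x hx).2, PiLp.smul_apply, matrixCLM_apply]
      simp [mul_comm]
    · simp [image_eq_zero_of_notMem_tsupport hx]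

theorem IsOpen.exists_iUnion_isCompact {X : Type*} [TopologicalSpace X] [LocallyCompactSpace X]
    [SecondCountableTopology X] {U : Set X} (hU : IsOpen U) :
    ∃ K : ℕ → Set X, (∀ k, IsCompact (K k)) ∧ ⋃ k, K k = U := by
  have := hU.locallyCompactSpace
  exact isSigmaCompact_iff_sigmaCompactSpace.2 inferInstance

theorem HasLocSobolevDeriv.exists_hasFDerivWithinAt (h : HasLocSobolevDeriv Ω f Df)
    (hΩ : IsOpen Ω) (hf : ContinuousOn f Ω) :
    ∃ A : ℕ → Set (Rn n), (∀ m, MeasurableSet (A m)) ∧ (∀ m, A m ⊆ Ω) ∧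
      volume (Ω \ ⋃ m, A m) = 0 ∧
      ∀ m, ∀ x ∈ A m, HasFDerivWithinAt f (matrixCLM (Df x)) (A m) x := by
  obtain ⟨K, hK, hKU⟩ := hΩ.exists_iUnion_isCompact
  have hKΩ : ∀ k, K k ⊆ Ω := fun k => hKU ▸ subset_iUnion K k
  have hex : ∀ k, ∃ A : ℕ → Set (Rn n), (∀ m, MeasurableSet (A m)) ∧ (∀ m, A m ⊆ K k) ∧
      volume (K k \ ⋃ m, A m) = 0 ∧
      ∀ m, ∀ x ∈ A m, HasFDerivWithinAt f (matrixCLM (Df x)) (A m) x := by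
    intro k
    obtain ⟨u, g, hu, -, hg, hw, heq⟩ := h.exists_hasWeakFDeriv hΩ hf (hK k) (hKΩ k)
    obtain ⟨A, hA, hA0, hAd⟩ := hw.exists_hasFDerivWithinAt hu hg
    refine ⟨fun m => A m ∩ K k, fun m => (hA m).inter (hK k).measurableSet,
      fun m => inter_subset_right, measure_mono_null ?_ hA0, fun m x hx => ?_⟩
    · rw [← iUnion_inter]
      exact fun x hx hc => hx.2 ⟨hc, hx.1⟩
    · have h1 := (hAd m x hx.1).mono (inter_subset_left : A m ∩ K k ⊆ A m)
      rw [(heq x hx.2).2] at h1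
      exact h1.congr (fun y hy => ((heq y hy.2).1).symm) ((heq x hx.2).1).symm
  choose A hA hAK hA0 hAd using hex
  refine ⟨fun m => A m.unpair.1 m.unpair.2, fun m => hA _ _, fun m => (hAK _ _).trans (hKΩ _),
    measure_mono_null (t := ⋃ k, K k \ ⋃ m, A k m) ?_ (measure_iUnion_null hA0),
    fun m => hAd _ _⟩
  rintro x ⟨hx, hxA⟩
  rw [← hKU] at hx
  obtain ⟨k, hk⟩ := mem_iUnion.1 hx
  refine mem_iUnion.2 ⟨k, hk, fun hc => hxA ?_⟩
  obtain ⟨m, hm⟩ := mem_iUnion.1 hc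
  exact mem_iUnion.2 ⟨Nat.pair k m, by simpa using hm⟩

end Localization

/-! ### The variation measure of a Sobolev map is `|Df| dx` -/

section TotalVariation

open Metric Filter Topology

variable {n d : ℕ}

/-- The entries of a matrix as a vector in Euclidean space. -/
noncomputable def matrixVec (A : Matrix (Fin d) (Fin n) ℝ) : EuclideanSpace ℝ (Fin d × Fin n) :=
  WithLp.toLp 2 fun p => A p.1 p.2

theorem norm_matrixVec (A : Matrix (Fin d) (Fin n) ℝ) : ‖matrixVec A‖ = ‖A‖ := by
  rw [EuclideanSpace.norm_eq, Matrix.frobenius_norm_def, Real.sqrt_eq_rpow, Fintype.sum_prod_type]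
  simp [matrixVec]

theorem enorm_matrixVec (A : Matrix (Fin d) (Fin n) ℝ) : ‖matrixVec A‖ₑ = ‖A‖ₑ := by
  rw [← ofReal_norm, ← ofReal_norm, norm_matrixVec]

theorem inner_matrixVec (A B : Matrix (Fin d) (Fin n) ℝ) :
    inner ℝ (matrixVec A) (matrixVec B) = ∑ i, ∑ j, A i j * B i j := by
  rw [PiLp.inner_apply, Fintype.sum_prod_type]
  simp [matrixVec, mul_comm]

theorem matrixVec_zero : matrixVec (0 : Matrix (Fin d) (Fin n) ℝ) = 0 := rfl

/-- The matrix with prescribed entries. -/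
def vecMatrix (v : EuclideanSpace ℝ (Fin d × Fin n)) : Matrix (Fin d) (Fin n) ℝ :=
  Matrix.of fun i j => v (i, j)

theorem matrixVec_vecMatrix (v : EuclideanSpace ℝ (Fin d × Fin n)) :
    matrixVec (vecMatrix v) = v := rfl

theorem vecMatrix_zero : vecMatrix (0 : EuclideanSpace ℝ (Fin d × Fin n)) = 0 := rfl

variable {Ω : Set (Rn n)} {f : Rn n → Rn d} {Df : Rn n → Matrix (Fin d) (Fin n) ℝ}

theorem HasLocSobolevDeriv.locallyIntegrableOn_matrixVec (h : HasLocSobolevDeriv Ω f Df) :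
    LocallyIntegrableOn (fun x => matrixVec (Df x)) Ω volume := by
  have e : (fun x => matrixVec (Df x)) =
      fun x => ∑ p : Fin d × Fin n, Df x p.1 p.2 • EuclideanSpace.single p (1 : ℝ) := by
    funext x
    ext p
    simp [matrixVec, Finset.sum_apply, Pi.single_apply]
  rw [e]
  exact LocallyIntegrableOn.sum_smul_const (a := fun (p : Fin d × Fin n) x => Df x p.1 p.2)
    (fun p => h.locallyIntegrableOn_deriv p.1 p.2) _

theorem tsupport_entry_subset (φ : Rn n → Matrix (Fin d) (Fin n) ℝ) (i : Fin d) (j : Fin n) :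
    tsupport (fun x => φ x i j) ⊆ tsupport φ := by
  refine closure_mono fun x hx hc => hx ?_
  simp only [hc, Matrix.zero_apply]

theorem HasLocSobolevDeriv.sum_integral_mul_div_eq (h : HasLocSobolevDeriv Ω f Df)
    (hΩ : IsOpen Ω) (hf : ContinuousOn f Ω) {G : Set (Rn n)} (hG : G ⊆ Ω)
    {φ : Rn n → Matrix (Fin d) (Fin n) ℝ} (hφ : IsTestField G φ) :
    ∑ i, ∫ x in G, f x i * ∑ j, partialDeriv j (fun y => φ y i j) x =
      - ∫ x, inner ℝ (matrixVec (Df x)) (matrixVec (φ x)) := by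
  have hs : ∀ i j, HasCompactSupport fun x => φ x i j := fun i j =>
    hφ.hasCompactSupport.isCompact.of_isClosed_subset (isClosed_tsupport _)
      (tsupport_entry_subset φ i j)
  have hsΩ : ∀ i j, tsupport (fun x => φ x i j) ⊆ Ω := fun i j =>
    ((tsupport_entry_subset φ i j).trans hφ.tsupport_subset).trans hG
  have hpsub : ∀ i j, tsupport (partialDeriv j fun x => φ x i j) ⊆ tsupport φ := fun i j =>
    (tsupport_fderiv_apply_subset ℝ _).trans (tsupport_entry_subset φ i j)
  have hfi : ∀ i, LocallyIntegrableOn (fun x => f x i) Ω volume := fun i x hx => by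
    obtain ⟨s, hs, hi⟩ := h.locallyIntegrableOn x hx
    exact ⟨s, hs, (EuclideanSpace.proj (𝕜 := ℝ) i).integrable_comp hi⟩
  have i1 : ∀ i j, Integrable fun x => f x i * partialDeriv j (fun y => φ y i j) x := by
    intro i j
    have hc : Continuous (partialDeriv j fun x => φ x i j) :=
      ((hφ.contDiff i j).continuous_fderiv one_ne_zero).clm_apply continuous_const
    refine ((hfi i).integrable_smul_of_tsupport_subset hc ((hs i j).fderiv_apply ℝ _)
      (((hpsub i j).trans hφ.tsupport_subset).trans hG)).congr (Eventually.of_forall fun x => ?_)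
    exact mul_comm _ _
  have i2 : ∀ i j, Integrable fun x => Df x i j * φ x i j := by
    intro i j
    refine ((h.locallyIntegrableOn_deriv i j).integrable_smul_of_tsupport_subset
      (hφ.contDiff i j).continuous (hs i j) (hsΩ i j)).congr (Eventually.of_forall fun x => ?_)
    exact mul_comm _ _
  simp only [inner_matrixVec]
  rw [integral_finsetSum _ fun i _ => integrable_finsetSum _ fun j _ => i2 i j,
    ← Finset.sum_neg_distrib]
  refine Finset.sum_congr rfl fun i _ => ?_
  rw [setIntegral_eq_integral_of_forall_compl_eq_zero]
  · simp only [Finset.mul_sum]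
    rw [integral_finsetSum _ fun j _ => i1 i j, integral_finsetSum _ fun j _ => i2 i j,
      ← Finset.sum_neg_distrib]
    exact Finset.sum_congr rfl fun j _ =>
      h.integral_fderiv_mul_of_contDiff_one hΩ hf (hφ.contDiff i j) (hs i j) (hsΩ i j) i j
  · intro x hx
    rw [Finset.sum_eq_zero, mul_zero]
    intro j _
    exact image_eq_zero_of_notMem_tsupport fun hc => hx (hφ.tsupport_subset (hpsub i j hc))

theorem HasLocSobolevDeriv.openVariation_le (h : HasLocSobolevDeriv Ω f Df)
    (hΩ : IsOpen Ω) (hf : ContinuousOn f Ω) {G : Set (Rn n)} (hGo : IsOpen G) (hG : G ⊆ Ω) :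
    openVariation f G ≤ ∫⁻ x in G, ‖Df x‖ₑ := by
  refine iSup₂_le fun φ hφ => ?_
  rw [h.sum_integral_mul_div_eq hΩ hf hG hφ]
  calc ENNReal.ofReal (- ∫ x, inner ℝ (matrixVec (Df x)) (matrixVec (φ x)))
      ≤ ‖∫ x, inner ℝ (matrixVec (Df x)) (matrixVec (φ x))‖ₑ := by
        rw [← ofReal_norm]
        exact ENNReal.ofReal_le_ofReal (neg_le_abs _)
    _ ≤ ∫⁻ x, ‖inner ℝ (matrixVec (Df x)) (matrixVec (φ x))‖ₑ := enorm_integral_le_lintegral_enorm _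
    _ ≤ ∫⁻ x, G.indicator (fun x => ‖Df x‖ₑ) x := by
        refine lintegral_mono fun x => ?_
        by_cases hx : x ∈ G
        · rw [indicator_of_mem hx, ← ofReal_norm, ← ofReal_norm]
          refine ENNReal.ofReal_le_ofReal ((norm_inner_le_norm _ _).trans ?_)
          rw [norm_matrixVec, norm_matrixVec]
          exact mul_le_of_le_one_right (norm_nonneg _) (hφ.norm_le_one x)
        · rw [image_eq_zero_of_notMem_tsupport fun hc => hx (hφ.tsupport_subset hc),
            matrixVec_zero, inner_zero_right]
          simp
    _ = _ := lintegral_indicator hGo.measurableSet _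

/-- The optimal field is `-Df / |Df|` on `K`. Its mollifications keep norm at most `1`, are
supported in `G` at small scales and converge a.e., so they are admissible and attain the integral
in the limit. -/
theorem HasLocSobolevDeriv.lintegral_isCompact_le_openVariation (h : HasLocSobolevDeriv Ω f Df)
    (hΩ : IsOpen Ω) (hf : ContinuousOn f Ω) {G : Set (Rn n)} (hGo : IsOpen G) (hG : G ⊆ Ω)
    {K : Set (Rn n)} (hK : IsCompact K) (hKG : K ⊆ G) :
    ∫⁻ x in K, ‖Df x‖ₑ ≤ openVariation f G := by
  obtain ⟨δ, hδ, hδG⟩ := hK.exists_cthickening_subset_open hGo hKG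
  have hKδ : IsCompact (cthickening δ K) := hK.cthickening
  set D : Rn n → EuclideanSpace ℝ (Fin d × Fin n) := fun x => matrixVec (Df x) with hD
  have hDfδ : IntegrableOn D (cthickening δ K) :=
    h.locallyIntegrableOn_matrixVec.integrableOn_compact_subset (hδG.trans hG) hKδ
  have hDfK : IntegrableOn D K := hDfδ.mono_set (self_subset_cthickening K)
  -- The minus sign offsets the one from integration by parts. Where `D x = 0` the field is zero.
  set ψ : Rn n → EuclideanSpace ℝ (Fin d × Fin n) :=
    K.indicator fun x => (-‖D x‖⁻¹) • D x with hψ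
  have hψ1 : ∀ x, ‖ψ x‖ ≤ 1 := by
    intro x
    by_cases hx : x ∈ K
    · rw [hψ, indicator_of_mem hx, norm_smul, norm_neg, norm_inv, norm_norm]
      exact inv_mul_le_one
    · rw [hψ, indicator_of_notMem hx, norm_zero]
      exact zero_le_one
  have hψm : AEStronglyMeasurable ψ volume := by
    rw [hψ, aestronglyMeasurable_indicator_iff hK.measurableSet]
    exact (hDfK.aestronglyMeasurable.norm.aemeasurable.inv.neg.aestronglyMeasurable).smul
      hDfK.aestronglyMeasurable
  have hψi : Integrable ψ := by
    refine IntegrableOn.integrable_of_forall_notMem_eq_zero (s := K) ?_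
      fun x hx => indicator_of_notMem hx _
    exact Measure.integrableOn_of_bounded hK.measure_lt_top.ne hψm
      (Eventually.of_forall hψ1)
  have hz : ∀ x ∉ K, ψ x = 0 := fun x hx => indicator_of_notMem hx _
  have hev : ∀ᶠ k in atTop, (shrinkingBump (Rn n) k).rOut < δ :=
    tendsto_rOut_shrinkingBump.eventually (gt_mem_nhds hδ)
  have hzero : ∀ k, (shrinkingBump (Rn n) k).rOut < δ → ∀ x ∉ cthickening δ K,
      mollify volume ψ k x = 0 := fun k hk x hx =>
    mollify_eq_zero_of_notMem_cthickening hz fun hc => hx (cthickening_mono hk.le _ hc)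
  have hsmooth : ∀ k, ContDiff ℝ 1 (mollify volume ψ k) := contDiff_mollify hψi.locallyIntegrable 1
  have htest : ∀ k, (shrinkingBump (Rn n) k).rOut < δ →
      IsTestField G fun x => vecMatrix (mollify volume ψ k x) := by
    intro k hk
    have hts : tsupport (fun x => vecMatrix (mollify volume ψ k x)) ⊆ cthickening δ K := by
      refine closure_minimal (fun x hx => ?_) isClosed_cthickening
      by_contra hc
      exact hx (by beta_reduce; rw [hzero k hk x hc, vecMatrix_zero])
    refine ⟨fun i j => (EuclideanSpace.proj (𝕜 := ℝ) (i, j)).contDiff.comp (hsmooth k),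
      hKδ.of_isClosed_subset (isClosed_tsupport _) hts, hts.trans hδG, fun x => ?_⟩
    rw [← norm_matrixVec, matrixVec_vecMatrix]
    exact norm_mollify_le hψ1 k x
  have hlim : Tendsto (fun k => - ∫ x, inner ℝ (D x) (mollify volume ψ k x)) atTop
      (𝓝 (- ∫ x, inner ℝ (D x) (ψ x))) := by
    refine (tendsto_integral_filter_of_dominated_convergence
      ((cthickening δ K).indicator fun x => ‖D x‖) ?_ ?_ ?_ ?_).neg
    · filter_upwards [hev] with k hk
      have h1 : AEStronglyMeasurable ((cthickening δ K).indicator fun x =>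
          (inner ℝ (D x) (mollify volume ψ k x) : ℝ)) volume := by
        rw [aestronglyMeasurable_indicator_iff hKδ.measurableSet]
        exact hDfδ.aestronglyMeasurable.inner (hsmooth k).continuous.aestronglyMeasurable
      refine h1.congr (Eventually.of_forall fun x => ?_)
      beta_reduce
      by_cases hx : x ∈ cthickening δ K
      · exact indicator_of_mem hx _
      · rw [indicator_of_notMem hx, hzero k hk x hx, inner_zero_right]
    · filter_upwards [hev] with k hk
      refine Eventually.of_forall fun x => ?_
      by_cases hx : x ∈ cthickening δ K
      · rw [indicator_of_mem hx]
        exact (norm_inner_le_norm _ _).trans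
          (mul_le_of_le_one_right (norm_nonneg _) (norm_mollify_le hψ1 k x))
      · rw [indicator_of_notMem hx, hzero k hk x hx, inner_zero_right, norm_zero]
    · exact (integrable_indicator_iff hKδ.measurableSet).2 hDfδ.norm
    · filter_upwards [ae_tendsto_mollify hψi.locallyIntegrable] with x hx
      exact tendsto_const_nhds.inner hx
  have hval : - ∫ x, inner ℝ (D x) (ψ x) = ∫ x in K, ‖D x‖ := by
    rw [← integral_indicator hK.measurableSet, ← integral_neg]
    congr 1 with x
    by_cases hx : x ∈ K
    · rw [hψ, indicator_of_mem hx, indicator_of_mem hx, inner_smul_right,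
        real_inner_self_eq_norm_sq]
      rcases eq_or_ne ‖D x‖ 0 with h0 | h0
      · simp [h0]
      · field_simp
    · rw [hz x hx, indicator_of_notMem hx, inner_zero_right, neg_zero]
  rw [hval] at hlim
  simp_rw [← enorm_matrixVec]
  rw [← ofReal_integral_norm_eq_lintegral_enorm hDfK]
  refine le_of_tendsto (ENNReal.tendsto_ofReal hlim) ?_
  filter_upwards [hev] with k hk
  have := h.sum_integral_mul_div_eq hΩ hf hG (htest k hk)
  simp only [matrixVec_vecMatrix] at this
  rw [← this]
  exact le_iSup₂_of_le (fun x => vecMatrix (mollify volume ψ k x)) (htest k hk) le_rfl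

theorem HasLocSobolevDeriv.openVariation_eq (h : HasLocSobolevDeriv Ω f Df)
    (hΩ : IsOpen Ω) (hf : ContinuousOn f Ω) {G : Set (Rn n)} (hGo : IsOpen G) (hG : G ⊆ Ω) :
    openVariation f G = ∫⁻ x in G, ‖Df x‖ₑ := by
  refine le_antisymm (h.openVariation_le hΩ hf hGo hG) ?_
  obtain ⟨K, hK, hKG⟩ := hGo.exists_iUnion_isCompact
  have hacc : ⋃ k, accumulate K k = G := by rw [iUnion_accumulate, hKG]
  rw [← hacc, setLIntegral_iUnion_of_directed _ (monotone_accumulate.directed_le), hacc]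
  refine iSup_le fun k => h.lintegral_isCompact_le_openVariation hΩ hf hGo hG
    (isCompact_accumulate hK k) ?_
  rw [← hacc]
  exact subset_iUnion _ k

/-- Outer regularity of `|Df| dx`. This measure is only locally finite in `Ω`, so `E` is cut by an
exhaustion `K k` and the `k`-th open neighbourhood is allowed an excess `e k`, with sum below `ε`.
-/
theorem HasLocSobolevDeriv.totalVariation_eq (h : HasLocSobolevDeriv Ω f Df)
    (hΩ : IsOpen Ω) (hf : ContinuousOn f Ω) {E : Set (Rn n)} (hE : MeasurableSet E)
    (hEΩ : E ⊆ Ω) : totalVariation Ω f E = ∫⁻ x in E, ‖Df x‖ₑ := by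
  apply le_antisymm
  · refine ENNReal.le_of_forall_pos_le_add fun ε hε _ => ?_
    obtain ⟨K, hK, hKΩ⟩ := hΩ.exists_iUnion_isCompact
    obtain ⟨e, he, hesum⟩ := ENNReal.exists_pos_sum_of_countable
      (ENNReal.coe_pos.2 hε).ne' ℕ
    have hU : ∀ k, ∃ U, IsOpen U ∧ E ∩ K k ⊆ U ∧ U ⊆ Ω ∧
        ∫⁻ x in U \ (E ∩ K k), ‖Df x‖ₑ ≤ e k := by
      intro k
      obtain ⟨L, hL, hKL, hLΩ⟩ := exists_compact_between (hK k) hΩ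
        (hKΩ ▸ subset_iUnion K k)
      have hi : IntegrableOn (fun x => matrixVec (Df x)) L :=
        h.locallyIntegrableOn_matrixVec.integrableOn_compact_subset hLΩ hL
      set ν := (volume.restrict L).withDensity fun x => ‖Df x‖ₑ with hν
      have : IsFiniteMeasure ν := by
        refine isFiniteMeasure_withDensity ?_
        simp_rw [← enorm_matrixVec]
        exact hi.hasFiniteIntegral.ne
      have hm : MeasurableSet (E ∩ K k) := hE.inter (hK k).measurableSet
      obtain ⟨U, hUE, hUo, -, hUlt⟩ := hm.exists_isOpen_sdiff_lt (μ := ν) (measure_ne_top _ _)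
        (ENNReal.coe_pos.2 (he k)).ne'
      -- `ν` sees only `L`, so cutting with its interior lets the bound for `ν` control the integral
      -- over the open set.
      refine ⟨U ∩ interior L, hUo.inter isOpen_interior,
        subset_inter hUE (inter_subset_right.trans hKL),
        inter_subset_right.trans (interior_subset.trans hLΩ), ?_⟩
      refine le_trans ?_ hUlt.le
      rw [hν, withDensity_apply _ (hUo.measurableSet.diff hm),
        Measure.restrict_restrict (hUo.measurableSet.diff hm)]
      exact lintegral_mono_set fun x hx => ⟨⟨hx.1.1, hx.2⟩, interior_subset hx.1.2⟩
    choose U hUo hUE hUΩ hUle using hU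
    have hGo : IsOpen (⋃ k, U k) := isOpen_iUnion hUo
    have hGΩ : ⋃ k, U k ⊆ Ω := iUnion_subset hUΩ
    have hEG : E ⊆ ⋃ k, U k := by
      intro x hx
      have := hEΩ hx
      rw [← hKΩ] at this
      obtain ⟨k, hk⟩ := mem_iUnion.1 this
      exact mem_iUnion.2 ⟨k, hUE k ⟨hx, hk⟩⟩
    calc totalVariation Ω f E ≤ openVariation f (⋃ k, U k) :=
          iInf_le_of_le _ (iInf_le_of_le hGo (iInf_le_of_le hEG (iInf_le _ hGΩ)))
      _ = ∫⁻ x in ⋃ k, U k, ‖Df x‖ₑ := h.openVariation_eq hΩ hf hGo hGΩ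
      _ ≤ ∫⁻ x in E ∪ ⋃ k, U k \ (E ∩ K k), ‖Df x‖ₑ := by
          refine lintegral_mono_set fun x hx => ?_
          obtain ⟨k, hk⟩ := mem_iUnion.1 hx
          by_cases hxE : x ∈ E
          · exact Or.inl hxE
          · exact Or.inr (mem_iUnion.2 ⟨k, hk, fun hc => hxE hc.1⟩)
      _ ≤ (∫⁻ x in E, ‖Df x‖ₑ) + ∫⁻ x in ⋃ k, U k \ (E ∩ K k), ‖Df x‖ₑ := lintegral_union_le _ _ _
      _ ≤ (∫⁻ x in E, ‖Df x‖ₑ) + ∑' k, ∫⁻ x in U k \ (E ∩ K k), ‖Df x‖ₑ := by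
          gcongr
          exact lintegral_iUnion_le _ _
      _ ≤ (∫⁻ x in E, ‖Df x‖ₑ) + ε := by
          gcongr
          exact (ENNReal.tsum_le_tsum hUle).trans hesum.le
  · refine le_iInf fun G => le_iInf fun hGo => le_iInf fun hEG => le_iInf fun hG => ?_
    rw [h.openVariation_eq hΩ hf hGo hG]
    exact lintegral_mono_set hEG

end TotalVariation

/-! ### Area formula off a null set -/

section AreaFormula

open Filter Topology

variable {n : ℕ}

theorem measurable_norm_matrix {α : Type*} [MeasurableSpace α] {d : ℕ}
    {D : α → Matrix (Fin d) (Fin n) ℝ} (hD : ∀ i j, Measurable fun x => D x i j) :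
    Measurable fun x => ‖D x‖ := by
  simp_rw [Matrix.frobenius_norm_def]
  exact (Finset.measurable_fun_sum _ fun i _ => Finset.measurable_fun_sum _ fun j _ =>
    (hD i j).norm.pow_const _).pow_const _

theorem measurable_det_matrix {α : Type*} [MeasurableSpace α]
    {D : α → Matrix (Fin n) (Fin n) ℝ} (hD : ∀ i j, Measurable fun x => D x i j) :
    Measurable fun x => (D x).det := by
  simp_rw [Matrix.det_apply']
  exact Finset.measurable_fun_sum _ fun σ _ =>
    (Finset.measurable_fun_prod _ fun i _ => hD (σ i) i).const_mul _

theorem OpenPartialHomeomorph.measurableSet_image {f : OpenPartialHomeomorph (Rn n) (Rn n)}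
    {E : Set (Rn n)} (hE : MeasurableSet E) (hEs : E ⊆ f.source) : MeasurableSet (f '' E) :=
  hE.image_of_continuousOn_injOn (f.continuousOn.mono hEs) (f.injOn.mono hEs)

theorem OpenPartialHomeomorph.measurableSet_source_inter_preimage
    {f : OpenPartialHomeomorph (Rn n) (Rn n)} {A : Set (Rn n)} (hA : MeasurableSet A)
    (hAt : A ⊆ f.target) : MeasurableSet (f.source ∩ f ⁻¹' A) := by
  have := f.symm.image_eq_target_inter_inv_preimage hAt
  rw [f.symm_symm, f.symm_target] at this
  rw [← this]
  exact f.symm.measurableSet_image hA hAt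

variable {f : OpenPartialHomeomorph (Rn n) (Rn n)} {Df : Rn n → Matrix (Fin n) (Fin n) ℝ}

/-- `Du` is only a.e. measurable; sets such as `{det ≠ 0}` must be measurable before their images
are taken. -/
theorem HasLocSobolevDeriv.exists_measurable_ae_eq {d : ℕ} {Ω : Set (Rn n)} {u : Rn n → Rn d}
    {Du : Rn n → Matrix (Fin d) (Fin n) ℝ} (h : HasLocSobolevDeriv Ω u Du) :
    ∃ D : Rn n → Matrix (Fin d) (Fin n) ℝ, (∀ i j, Measurable fun x => D x i j) ∧
      ∀ᵐ x ∂volume.restrict Ω, Du x = D x := by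
  have hm : ∀ i j, AEMeasurable (fun x => Du x i j) (volume.restrict Ω) := fun i j =>
    (h.locallyIntegrableOn_deriv i j).aestronglyMeasurable.aemeasurable
  refine ⟨fun x => Matrix.of fun i j => (hm i j).mk _ x, fun i j => (hm i j).measurable_mk, ?_⟩
  filter_upwards [ae_all_iff.2 fun i => ae_all_iff.2 fun j => (hm i j).ae_eq_mk] with x hx
  ext i j
  exact hx i j

/-- The area formula for a Sobolev homeomorphism holds off a null set. -/
theorem HasLocSobolevDeriv.exists_lintegral_image_eq (h : HasLocSobolevDeriv f.source f Df) :
    ∃ S : Set (Rn n), MeasurableSet S ∧ S ⊆ f.source ∧ volume (f.source \ S) = 0 ∧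
      ∀ E ⊆ S, MeasurableSet E → ∀ g : Rn n → ℝ≥0∞,
        ∫⁻ y in f '' E, g y = ∫⁻ x in E, ENNReal.ofReal |(Df x).det| * g (f x) := by
  obtain ⟨A, hA, hAs, hA0, hAd⟩ := h.exists_hasFDerivWithinAt f.open_source f.continuousOn
  refine ⟨⋃ m, A m, MeasurableSet.iUnion hA, iUnion_subset hAs, hA0, fun E hES hE g => ?_⟩
  -- Disjoint pieces have disjoint images by injectivity, so the change of variables formula can be
  -- summed over them.
  set B : ℕ → Set (Rn n) := fun m => E ∩ disjointed A m with hB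
  have hBm : ∀ m, MeasurableSet (B m) := fun m => hE.inter (MeasurableSet.disjointed hA m)
  have hBA : ∀ m, B m ⊆ A m := fun m => inter_subset_right.trans (disjointed_subset A m)
  have hBs : ∀ m, B m ⊆ f.source := fun m => (hBA m).trans (hAs m)
  have hBd : Pairwise (Function.onFun Disjoint B) := fun i j hij =>
    (disjoint_disjointed A hij).mono inter_subset_right inter_subset_right
  have hBU : ⋃ m, B m = E := by
    rw [hB, ← inter_iUnion, iUnion_disjointed]
    exact inter_eq_left.2 hES
  have hfd : Pairwise (Function.onFun Disjoint fun m => f '' B m) := by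
    intro i j hij
    refine disjoint_left.2 ?_
    rintro _ ⟨x, hx, rfl⟩ ⟨y, hy, hxy⟩
    rw [f.injOn (hBs j hy) (hBs i hx) hxy] at hy
    exact disjoint_left.1 (hBd hij) hx hy
  rw [← hBU, image_iUnion, lintegral_iUnion (fun m => f.measurableSet_image (hBm m) (hBs m)) hfd,
    lintegral_iUnion hBm hBd]
  refine tsum_congr fun m => ?_
  have hd : ∀ x ∈ B m, HasFDerivWithinAt f (matrixCLM (Df x)) (B m) x := fun x hx =>
    (hAd m x (hBA m hx)).mono (hBA m)
  rw [lintegral_image_eq_lintegral_abs_det_fderiv_mul volume (hBm m) hd (f.injOn.mono (hBs m)) g]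
  simp only [det_matrixCLM]

end AreaFormula

/-! ### The two implications -/

section Equivalence

open Filter Topology

theorem Real.HolderConjugate.mul_div_rpow_eq {q p a j : ℝ} (hpq : q.HolderConjugate p)
    (ha : 0 ≤ a) (hj : 0 < j) : j * (a / j) ^ p = (a * j ^ (-(1 / q))) ^ p := by
  have hp : 1 - p = -(1 / q) * p := by
    have h1 := hpq.inv_add_inv_eq_one
    have h2 := hpq.symm.pos.ne'
    have h3 : 1 / q = 1 - p⁻¹ := by rw [one_div]; linarith
    rw [h3, neg_mul, sub_mul, inv_mul_cancel₀ h2]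
    ring
  rw [Real.div_rpow ha hj.le, Real.mul_rpow ha (Real.rpow_nonneg hj.le _), ← Real.rpow_mul hj.le,
    ← hp, Real.rpow_sub hj, Real.rpow_one]
  ring

variable {n : ℕ} {f : OpenPartialHomeomorph (Rn n) (Rn n)}
  {Df : Rn n → Matrix (Fin n) (Fin n) ℝ}

/-- A bound for the push-forward of `|Df|` gives a pointwise bound for the weak derivative. -/
theorem HasLocSobolevDeriv.ae_enorm_le_of_lintegral_le (h : HasLocSobolevDeriv f.source f Df)
    {k : Rn n → ℝ≥0∞} (hk : ∀ A ⊆ f.target, MeasurableSet A →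
      ∫⁻ x in f.source ∩ f ⁻¹' A, ‖Df x‖ₑ ≤ ∫⁻ y in A, k y) :
    ∀ᵐ x ∂volume.restrict f.source, ‖Df x‖ₑ ≤ ENNReal.ofReal |(Df x).det| * k (f x) := by
  obtain ⟨S, hS, hSs, hS0, harea⟩ := h.exists_lintegral_image_eq
  obtain ⟨D, hD, hDae⟩ := h.exists_measurable_ae_eq
  have hSae : (S : Set (Rn n)) =ᵐ[volume] f.source :=
    (ae_eq_set.2 ⟨by rw [sdiff_eq_empty.2 hSs, measure_empty], hS0⟩)
  rw [← Measure.restrict_congr_set hSae] at hDae ⊢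
  have hm : AEMeasurable (fun x => ‖Df x‖ₑ) (volume.restrict S) := by
    refine (ENNReal.measurable_ofReal.comp (measurable_norm_matrix hD)).aemeasurable.congr ?_
    filter_upwards [hDae] with x hx
    rw [Function.comp_apply, ← hx, ofReal_norm]
  -- Compare integrals over arbitrary measurable `E`: the hypothesis with `A = f '' (E ∩ S)`
  -- followed by the area formula on `E ∩ S`.
  refine ae_le_of_forall_setLIntegral_le_of_sigmaFinite₀ hm fun E hE _ => ?_
  rw [Measure.restrict_restrict hE]
  have hEs : E ∩ S ⊆ f.source := inter_subset_right.trans hSs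
  have hi : f '' (E ∩ S) ⊆ f.target := by
    rintro _ ⟨x, hx, rfl⟩
    exact f.map_source (hEs hx)
  calc ∫⁻ x in E ∩ S, ‖Df x‖ₑ
      ≤ ∫⁻ x in f.source ∩ f ⁻¹' (f '' (E ∩ S)), ‖Df x‖ₑ :=
        lintegral_mono_set fun x hx => ⟨hEs hx, mem_image_of_mem f hx⟩
    _ ≤ ∫⁻ y in f '' (E ∩ S), k y := hk _ hi (f.measurableSet_image (hE.inter hS) hEs)
    _ = _ := harea _ inter_subset_right (hE.inter hS) k

theorem HasLocSobolevDeriv.aestronglyMeasurable_outerDistortion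
    (h : HasLocSobolevDeriv f.source f Df) (s : ℝ) :
    AEStronglyMeasurable (fun x => ‖Df x‖ * |(Df x).det| ^ s) (volume.restrict f.source) := by
  obtain ⟨D, hD, hDae⟩ := h.exists_measurable_ae_eq
  have hm : Measurable fun x => ‖D x‖ * |(D x).det| ^ s :=
    (measurable_norm_matrix hD).mul ((measurable_det_matrix hD).abs.pow_const s)
  refine hm.aestronglyMeasurable.congr ?_
  filter_upwards [hDae] with x hx
  rw [hx]

theorem HasLocSobolevDeriv.exists_memLp_distortion (h : HasLocSobolevDeriv f.source f Df)
    {q : ℝ} (hq : 1 ≤ q) {q' : ℝ≥0∞} (hqq' : ENNReal.HolderConjugate (ENNReal.ofReal q) q')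
    {K : Rn n → ℝ} (hK : MemLp K q' (volume.restrict f.target))
    (hle : ∀ A ⊆ f.target, MeasurableSet A →
      ∫⁻ x in f.source ∩ f ⁻¹' A, ‖Df x‖ₑ ≤ ∫⁻ y in A, ENNReal.ofReal (K y)) :
    ∃ L : Rn n → ℝ, MemLp L q' (volume.restrict f.source) ∧
      ∀ᵐ x ∂volume.restrict f.source, ‖Df x‖ ≤ L x * |(Df x).det| ^ (1 / q) := by
  have hq0 : 0 < q := zero_lt_one.trans_le hq
  have hae := h.ae_enorm_le_of_lintegral_le hle
  -- Where the Jacobian vanishes, the convention that a nonzero real power of `0` is `0` makes this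
  -- function zero; `Df` vanishes a.e. there too, by `hae`.
  refine ⟨fun x => ‖Df x‖ * |(Df x).det| ^ (-(1 / q)),
    ⟨h.aestronglyMeasurable_outerDistortion _, ?_⟩, ?_⟩
  · rcases eq_or_lt_of_le hq with rfl | hq1
    · have hq' : q' = ⊤ := by
        have := hqq'.inv_add_inv_eq_inv
        simpa using this
      subst hq'
      set M := (eLpNorm K ⊤ (volume.restrict f.target)).toReal
      have hM : ∀ᵐ y ∂volume.restrict f.target, ENNReal.ofReal (K y) ≤ ENNReal.ofReal M := by
        filter_upwards [ae_le_eLpNormEssSup (f := K) (μ := volume.restrict f.target)] with y hy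
        rw [ENNReal.ofReal_toReal hK.2.ne, eLpNorm_exponent_top]
        refine le_trans ?_ hy
        rw [← ofReal_norm]
        exact ENNReal.ofReal_le_ofReal (le_abs_self _)
      -- Replacing `K` by its essential supremum before pulling back avoids the question whether
      -- preimages of null sets are null.
      have hae' := h.ae_enorm_le_of_lintegral_le (k := fun _ => ENNReal.ofReal M)
        fun A hA hAm => (hle A hA hAm).trans
          (lintegral_mono_ae (ae_restrict_of_ae_restrict_of_subset hA hM))
      refine (memLp_top_of_bound (h.aestronglyMeasurable_outerDistortion _) M ?_).2
      filter_upwards [hae'] with x hx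
      rw [← ofReal_norm, ← ENNReal.ofReal_mul (abs_nonneg _),
        ENNReal.ofReal_le_ofReal_iff (by positivity)] at hx
      rw [Real.norm_of_nonneg (by positivity)]
      norm_num
      rcases eq_or_ne (Df x).det 0 with h0 | h0
      · rw [h0]
        simp [M]
      · have hj : 0 < |(Df x).det| := abs_pos.2 h0
        rw [Real.rpow_neg_one, ← div_eq_mul_inv, div_le_iff₀ hj, mul_comm]
        exact hx
    · have hpq : q.HolderConjugate q'.toReal := by
        have := ENNReal.HolderConjugate.toReal (p := ENNReal.ofReal q) (q := q')
          (by rwa [ENNReal.toReal_ofReal hq0.le])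
        rwa [ENNReal.toReal_ofReal hq0.le] at this
      have hp0 : 0 < q'.toReal := hpq.symm.pos
      have hq'0 : q' ≠ 0 := fun hc => by simp [hc] at hp0
      have hq't : q' ≠ ⊤ := fun hc => by simp [hc] at hp0
      set p := q'.toReal with hp
      rw [eLpNorm_lt_top_iff_lintegral_rpow_enorm_lt_top hq'0 hq't, ← hp]
      have hKfin := (eLpNorm_lt_top_iff_lintegral_rpow_enorm_lt_top hq'0 hq't).1 hK.2
      rw [← hp] at hKfin
      obtain ⟨S, hS, hSs, hS0, harea⟩ := h.exists_lintegral_image_eq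
      have hSae : (S : Set (Rn n)) =ᵐ[volume] f.source :=
        (ae_eq_set.2 ⟨by rw [sdiff_eq_empty.2 hSs, measure_empty], hS0⟩)
      calc ∫⁻ x in f.source, ‖‖Df x‖ * |(Df x).det| ^ (-(1 / q))‖ₑ ^ p
          ≤ ∫⁻ x in f.source, ENNReal.ofReal |(Df x).det| * ‖K (f x)‖ₑ ^ p := by
            refine lintegral_mono_ae ?_
            filter_upwards [hae] with x hx
            rcases eq_or_ne (Df x).det 0 with h0 | h0
            · rw [h0, abs_zero, Real.zero_rpow (by simpa using hq0.ne'), mul_zero, enorm_zero,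
                ENNReal.zero_rpow_of_pos hp0]
              exact zero_le
            · have hj : 0 < |(Df x).det| := abs_pos.2 h0
              rw [← ofReal_norm, ← ENNReal.ofReal_mul (abs_nonneg _)] at hx
              have hK0 : ‖Df x‖ ≤ |(Df x).det| * |K (f x)| := by
                have h1 : ENNReal.ofReal ‖Df x‖ ≤ ENNReal.ofReal (|(Df x).det| * |K (f x)|) :=
                  hx.trans (ENNReal.ofReal_le_ofReal (by gcongr; exact le_abs_self _))
                rwa [ENNReal.ofReal_le_ofReal_iff (by positivity)] at h1
              rw [← ofReal_norm, ← ofReal_norm, Real.norm_of_nonneg (by positivity),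
                ENNReal.ofReal_rpow_of_nonneg (by positivity) hp0.le,
                ENNReal.ofReal_rpow_of_nonneg (by positivity) hp0.le,
                ← ENNReal.ofReal_mul (abs_nonneg _)]
              refine ENNReal.ofReal_le_ofReal ?_
              rw [← hpq.mul_div_rpow_eq (norm_nonneg _) hj]
              gcongr
              rw [div_le_iff₀ hj, mul_comm]
              exact hK0
        _ = ∫⁻ x in S, ENNReal.ofReal |(Df x).det| * ‖K (f x)‖ₑ ^ p := by
            rw [Measure.restrict_congr_set hSae]
        _ = ∫⁻ y in f '' S, ‖K y‖ₑ ^ p := (harea S Subset.rfl hS fun y => ‖K y‖ₑ ^ p).symm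
        _ ≤ ∫⁻ y in f.target, ‖K y‖ₑ ^ p := by
            refine lintegral_mono_set ?_
            rintro _ ⟨x, hx, rfl⟩
            exact f.map_source (hSs hx)
        _ < ⊤ := hKfin
  · filter_upwards [hae] with x hx
    rcases eq_or_ne (Df x).det 0 with h0 | h0
    · rw [h0] at hx
      have : ‖Df x‖ = 0 := by
        rw [← ofReal_norm, abs_zero, ENNReal.ofReal_zero, zero_mul, nonpos_iff_eq_zero,
          ENNReal.ofReal_eq_zero] at hx
        exact le_antisymm hx (norm_nonneg _)
      rw [this, zero_mul, zero_mul]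
    · have hj : 0 < |(Df x).det| := abs_pos.2 h0
      rw [mul_assoc, ← Real.rpow_add hj, neg_add_cancel, Real.rpow_zero, mul_one]

/-- The density of the push-forward is `|Df| / |J_f|` read at `f⁻¹`. Points with zero Jacobian
contribute nothing, since the distortion inequality forces `Df = 0` there. -/
theorem HasLocSobolevDeriv.exists_memLp_density (h : HasLocSobolevDeriv f.source f Df)
    {q : ℝ} (hq : 1 ≤ q) {q' : ℝ≥0∞} (hqq' : ENNReal.HolderConjugate (ENNReal.ofReal q) q')
    {L : Rn n → ℝ} (hL : MemLp L q' (volume.restrict f.source))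
    (hle : ∀ᵐ x ∂volume.restrict f.source, ‖Df x‖ ≤ L x * |(Df x).det| ^ (1 / q)) :
    ∃ K : Rn n → ℝ, (∀ y, 0 ≤ K y) ∧ MemLp K q' (volume.restrict f.target) ∧
      ∀ A ⊆ f.target, MeasurableSet A →
        ∫⁻ x in f.source ∩ f ⁻¹' A, ‖Df x‖ₑ ≤ ∫⁻ y in A, ENNReal.ofReal (K y) := by
  have hq0 : 0 < q := zero_lt_one.trans_le hq
  obtain ⟨S, hS, hSs, hS0, harea⟩ := h.exists_lintegral_image_eq
  obtain ⟨D, hD, hDae⟩ := h.exists_measurable_ae_eq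
  have hSae : (S : Set (Rn n)) =ᵐ[volume] f.source :=
    (ae_eq_set.2 ⟨by rw [sdiff_eq_empty.2 hSs, measure_empty], hS0⟩)
  -- On `P` the area formula holds and the quotient `g` is meaningful; `K` is set to zero off `f ''
  -- P`.
  set P : Set (Rn n) := S ∩ {x | (D x).det ≠ 0} with hP
  have hPm : MeasurableSet P :=
    hS.inter (measurable_det_matrix hD (measurableSet_singleton 0).compl)
  have hPS : P ⊆ S := inter_subset_left
  have hPs : P ⊆ f.source := hPS.trans hSs
  set g : Rn n → ℝ := fun x => ‖D x‖ / |(D x).det| with hg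
  have hg0 : ∀ x, 0 ≤ g x := fun x => by positivity
  have hgm : Measurable g := (measurable_norm_matrix hD).div (measurable_det_matrix hD).abs
  have hPi : f '' P ⊆ f.target := by
    rintro _ ⟨x, hx, rfl⟩
    exact f.map_source (hPs hx)
  have hPim : MeasurableSet (f '' P) := f.measurableSet_image hPm hPs
  have hDaeP : ∀ {E : Set (Rn n)}, E ⊆ P → ∀ᵐ x ∂volume.restrict E, Df x = D x := fun hE =>
    ae_restrict_of_ae_restrict_of_subset (hE.trans hPs) hDae
  have hareaP : ∀ E ⊆ P, MeasurableSet E → ∀ k : ℝ → ℝ≥0∞,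
      ∫⁻ y in f '' E, k (g (f.symm y)) =
        ∫⁻ x in E, ENNReal.ofReal |(D x).det| * k (g x) := by
    intro E hE hEm k
    rw [harea E (hE.trans hPS) hEm]
    refine lintegral_congr_ae ?_
    filter_upwards [hDaeP hE, ae_restrict_mem hEm] with x hx hxE
    rw [hx, f.left_inv (hPs (hE hxE))]
  set K : Rn n → ℝ := (f '' P).indicator fun y => g (f.symm y) with hK
  have hKm : AEStronglyMeasurable K volume := by
    rw [hK, aestronglyMeasurable_indicator_iff hPim]
    exact (hgm.comp_aemeasurable
      ((f.symm.continuousOn.mono hPi).aemeasurable hPim)).aestronglyMeasurable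
  refine ⟨K, fun y => indicator_nonneg (fun y _ => hg0 _) y, ⟨hKm.restrict, ?_⟩,
    fun A hA hAm => ?_⟩
  · have hleP : ∀ᵐ x ∂volume.restrict P, ‖D x‖ ≤ L x * |(D x).det| ^ (1 / q) := by
      filter_upwards [hDaeP Subset.rfl, ae_restrict_of_ae_restrict_of_subset hPs hle] with x hx hx'
      rwa [hx] at hx'
    rcases eq_or_lt_of_le hq with rfl | hq1
    · have hq' : q' = ⊤ := by
        have := hqq'.inv_add_inv_eq_inv
        simpa using this
      subst hq'
      set M := (eLpNorm L ⊤ (volume.restrict f.source)).toReal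
      have hM : ∀ᵐ x ∂volume.restrict f.source, |L x| ≤ M := by
        filter_upwards [ae_le_eLpNormEssSup (f := L) (μ := volume.restrict f.source)] with x hx
        rw [← eLpNorm_exponent_top, ← ENNReal.ofReal_toReal hL.2.ne, ← ofReal_norm,
          ENNReal.ofReal_le_ofReal_iff ENNReal.toReal_nonneg] at hx
        exact hx
      set T : Set (Rn n) := P ∩ {x | M < g x} with hT
      have hTm : MeasurableSet T := hPm.inter (measurableSet_lt measurable_const hgm)
      have hT0 : volume T = 0 := by
        have : ∀ᵐ x ∂volume.restrict P, ¬ M < g x := by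
          filter_upwards [hleP, ae_restrict_of_ae_restrict_of_subset hPs hM,
            ae_restrict_mem hPm] with x hx hxM hxP
          have hj : 0 < |(D x).det| := abs_pos.2 hxP.2
          rw [not_lt, hg, div_le_iff₀ hj]
          norm_num at hx
          exact hx.trans (mul_le_mul_of_nonneg_right ((le_abs_self _).trans hxM) hj.le)
        rw [ae_restrict_iff' hPm] at this
        refine measure_mono_null ?_ this
        exact fun x hx hc => hc hx.1 hx.2
      -- The area formula with integrand `1` shows that `f` maps null subsets of `P` to null sets,
      -- so the bound on `g` transfers to `K`.
      have hfT : volume (f '' T) = 0 := by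
        have := hareaP T inter_subset_left hTm fun _ => 1
        rw [setLIntegral_one, Measure.restrict_eq_zero.2 hT0, lintegral_zero_measure] at this
        exact this
      refine (memLp_top_of_bound hKm.restrict M (ae_restrict_of_ae ?_)).2
      filter_upwards [measure_eq_zero_iff_ae_notMem.1 hfT] with y hy
      by_cases hyP : y ∈ f '' P
      · rw [hK, indicator_of_mem hyP, Real.norm_of_nonneg (hg0 _)]
        obtain ⟨x, hx, rfl⟩ := hyP
        rw [f.left_inv (hPs hx)]
        by_contra! hc
        exact hy ⟨x, ⟨hx, hc⟩, rfl⟩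
      · rw [hK, indicator_of_notMem hyP, norm_zero]
        exact ENNReal.toReal_nonneg
    · have hpq : q.HolderConjugate q'.toReal := by
        have := ENNReal.HolderConjugate.toReal (p := ENNReal.ofReal q) (q := q')
          (by rwa [ENNReal.toReal_ofReal hq0.le])
        rwa [ENNReal.toReal_ofReal hq0.le] at this
      have hp0 : 0 < q'.toReal := hpq.symm.pos
      have hq'0 : q' ≠ 0 := fun hc => by simp [hc] at hp0
      have hq't : q' ≠ ⊤ := fun hc => by simp [hc] at hp0
      set p := q'.toReal with hp
      rw [eLpNorm_lt_top_iff_lintegral_rpow_enorm_lt_top hq'0 hq't, ← hp]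
      have hLfin := (eLpNorm_lt_top_iff_lintegral_rpow_enorm_lt_top hq'0 hq't).1 hL.2
      rw [← hp] at hLfin
      calc ∫⁻ y in f.target, ‖K y‖ₑ ^ p
          ≤ ∫⁻ y, (f '' P).indicator (fun y => ‖g (f.symm y)‖ₑ ^ p) y := by
            refine (lintegral_mono' Measure.restrict_le_self le_rfl).trans
              (lintegral_mono fun y => ?_)
            by_cases hyP : y ∈ f '' P
            · rw [hK, indicator_of_mem hyP, indicator_of_mem hyP]
            · rw [hK, indicator_of_notMem hyP, indicator_of_notMem hyP, enorm_zero,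
                ENNReal.zero_rpow_of_pos hp0]
        _ = ∫⁻ y in f '' P, ‖g (f.symm y)‖ₑ ^ p := lintegral_indicator hPim _
        _ = ∫⁻ x in P, ENNReal.ofReal |(D x).det| * ‖g x‖ₑ ^ p :=
            hareaP P Subset.rfl hPm fun t => ‖t‖ₑ ^ p
        _ ≤ ∫⁻ x in P, ‖L x‖ₑ ^ p := by
            refine lintegral_mono_ae ?_
            filter_upwards [hleP, ae_restrict_mem hPm] with x hx hxP
            have hj : 0 < |(D x).det| := abs_pos.2 hxP.2
            rw [← ofReal_norm, ← ofReal_norm, Real.norm_of_nonneg (hg0 x),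
              ENNReal.ofReal_rpow_of_nonneg (hg0 x) hp0.le,
              ENNReal.ofReal_rpow_of_nonneg (by positivity) hp0.le,
              ← ENNReal.ofReal_mul (abs_nonneg _)]
            refine ENNReal.ofReal_le_ofReal ?_
            rw [hg, hpq.mul_div_rpow_eq (norm_nonneg _) hj]
            refine Real.rpow_le_rpow (by positivity) ?_ hp0.le
            rw [Real.rpow_neg hj.le, ← div_eq_mul_inv, div_le_iff₀ (by positivity)]
            exact hx.trans (mul_le_mul_of_nonneg_right (le_abs_self _) (by positivity))
        _ ≤ ∫⁻ x in f.source, ‖L x‖ₑ ^ p := lintegral_mono_set hPs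
        _ < ⊤ := hLfin
  · have hEm : MeasurableSet (f.source ∩ f ⁻¹' A) :=
      OpenPartialHomeomorph.measurableSet_source_inter_preimage hAm hA
    set E := f.source ∩ f ⁻¹' A with hE
    calc ∫⁻ x in E, ‖Df x‖ₑ
        ≤ ∫⁻ x in E, P.indicator
            (fun x => ENNReal.ofReal |(D x).det| * ENNReal.ofReal (g x)) x := by
          refine lintegral_mono_ae ?_
          have hES : ∀ᵐ x ∂volume.restrict E, x ∈ S := by
            refine ae_restrict_of_ae_restrict_of_subset (inter_subset_left : E ⊆ f.source) ?_
            rw [← Measure.restrict_congr_set hSae]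
            exact ae_restrict_mem hS
          filter_upwards [hES, ae_restrict_of_ae_restrict_of_subset inter_subset_left hDae,
            ae_restrict_of_ae_restrict_of_subset inter_subset_left hle] with x hxS hxD hx
          rw [hxD] at hx ⊢
          -- With zero Jacobian the right side of the inequality vanishes, since `1 / q ≠ 0`, and so
          -- `Df = 0`; otherwise `|J_f| * g = |Df|` exactly.
          by_cases h0 : (D x).det = 0
          · rw [h0, abs_zero, Real.zero_rpow (by simpa using hq0.ne'), mul_zero] at hx
            rw [← ofReal_norm, ENNReal.ofReal_eq_zero.2 hx]
            exact zero_le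
          · have hj : 0 < |(D x).det| := abs_pos.2 h0
            rw [indicator_of_mem (show x ∈ P from ⟨hxS, h0⟩), ← ENNReal.ofReal_mul hj.le, hg,
              mul_div_cancel₀ _ hj.ne', ofReal_norm]
      _ = ∫⁻ x in P ∩ E, ENNReal.ofReal |(D x).det| * ENNReal.ofReal (g x) := by
          rw [lintegral_indicator hPm, Measure.restrict_restrict hPm]
      _ = ∫⁻ y in f '' (P ∩ E), ENNReal.ofReal (g (f.symm y)) :=
          (hareaP _ inter_subset_left (hPm.inter hEm) ENNReal.ofReal).symm
      _ = ∫⁻ y in f '' (P ∩ E), ENNReal.ofReal (K y) := by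
          refine setLIntegral_congr_fun (f.measurableSet_image (hPm.inter hEm)
            (inter_subset_left.trans hPs)) fun y hy => ?_
          rw [hK, indicator_of_mem (image_mono inter_subset_left hy)]
      _ ≤ ∫⁻ y in A, ENNReal.ofReal (K y) := by
          refine lintegral_mono_set ?_
          rintro _ ⟨x, hx, rfl⟩
          exact hx.2.2

end Equivalence

theorem mainTheorem4 (n : ℕ) (Ω₁ Ω₂ : Set (Rn n))
    (f : OpenPartialHomeomorph (Rn n) (Rn n)) (hsource : f.source = Ω₁) (htarget : f.target = Ω₂)
    (Df : Rn n → Matrix (Fin n) (Fin n) ℝ) (hDf : HasLocSobolevDeriv Ω₁ f Df)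
    (q : ℝ) (hq : 1 ≤ q) (q' : ℝ≥0∞) (hqq' : ENNReal.HolderConjugate (ENNReal.ofReal q) q') :
    (∃ K : Rn n → ℝ, (∀ y, 0 ≤ K y) ∧ MemLp K q' (volume.restrict Ω₂) ∧
        ∀ A : Set (Rn n), MeasurableSet A → A ⊆ Ω₂ →
          totalVariation Ω₁ f (Ω₁ ∩ f ⁻¹' A) ≤ ∫⁻ y in A, ENNReal.ofReal (K y)) ↔
      (∃ L : Rn n → ℝ, MemLp L q' (volume.restrict Ω₁) ∧
        ∀ᵐ x ∂(volume.restrict Ω₁), ‖Df x‖ ≤ L x * |(Df x).det| ^ (1 / q)) := by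
  subst hsource htarget
  have hvar : ∀ A ⊆ f.target, MeasurableSet A → totalVariation f.source f (f.source ∩ f ⁻¹' A) =
      ∫⁻ x in f.source ∩ f ⁻¹' A, ‖Df x‖ₑ := fun A hA hAm =>
    hDf.totalVariation_eq f.open_source f.continuousOn
      (OpenPartialHomeomorph.measurableSet_source_inter_preimage hAm hA) inter_subset_left
  constructor
  · rintro ⟨K, -, hK, hle⟩
    exact hDf.exists_memLp_distortion hq hqq' hK fun A hA hAm =>
      (hvar A hA hAm).symm.trans_le (hle A hAm hA)
  · rintro ⟨L, hL, hle⟩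
    obtain ⟨K, hK0, hK, hKle⟩ := hDf.exists_memLp_density hq hqq' hL hle
    exact ⟨K, hK0, hK, fun A hAm hA => (hvar A hA hAm).trans_le (hKle A hA hAm)⟩
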